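/- \textbf{Setting.} Let $N,M\ge 1$, $P_s>0$, let $P_1,\dots,P_N>0$ be pairwise distinct, let $\sigma_D>0$, $\sigma_{E_1},\dots,\sigma_{E_M}>0$ and $\mathcal R>0$. Let $h_D$, $g_D^{(n)}$, $h_{E_m}$, $g_{E_m}^{(n)}$ ($1\le n\le N$, $1\le m\le M$) be independent standard circularly-symmetric complex Gaussian random variables (real and imaginary parts independent $\mathcal N(0,\tfrac12)$), and put $$\gamma_D=\frac{P_s|h_D|^2}{\sum_{n}P_n|g_D^{(n)}|^2+\sigma_D^2},\qquad \gamma_{E_m}=\frac{P_s|h_{E_m}|^2}{\sum_{n}P_n|g_{E_m}^{(n)}|^2+\sigma_{E_m}^2},\qquad \gamma_{E_{\max}}=\max_m\gamma_{E_m}.$$ The secrecy outage probability is $$P_{\rm out}=\Pr\Big[\log_2\tfrac{\gamma_D+1}{\gamma_{E_{\max}}+1}<\mathcal R\ \Big|\ \gamma_D>\gamma_{E_{\max}}\Big]\Pr[\gamma_D>\gamma_{E_{\max}}]+\Pr[\gamma_D\le\gamma_{E_{\max}}].$$ Let $\mu=2^{\mathcal R}$, $\nu=2^{-\mathcal R}-1$,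 $\mathcal A_n=\big[P_n\prod_{j\ne n}(1-P_j/P_n)\big]^{-1}$, $\xi=\sigma_D^2\mu/P_s$, $\kappa_n=P_s/(\mu P_n)-\nu$, $\lambda_n=P_s/P_n$, and $\psi_S=\xi+P_s^{-1}\sum_{j\in S}\sigma_{E_j}^2$ for $S\subseteq\{1,\dots,M\}$. For $\ell\in\{1,2\}$, $k\in\mathbb Z_{\ge0}^N$, $a_1,a_2>0$ and reals $a_{3,n}$ such that the $a_{3,n}$ with $k_n\ge1$ are positive and pairwise distinct, let $$I_{\ell,k}(a_1,a_2,a_3)=\int_0^\infty\frac{e^{-a_1x}}{(x+a_2)^\ell\prod_{n=1}^N(x+a_{3,n})^{k_n}}\,dx .$$ \textbf{Claim.} (1) $P_{\rm out}=1-\mu e^{\xi\nu}\,Y$, where $Y$ is the absolutely convergent integral $$Y=\int_0^\infty\prod_{i=1}^M\Big[1-P_se^{-\sigma_{E_i}^2x/P_s}\sum_{n=1}^N\frac{\mathcal A_n}{x+\lambda_n}\Big]e^{-\xi x}\sum_{n=1}^N\frac{\mathcal A_n}{\mu}\Big[\frac{\sigma_D^2}{x+\kappa_n}+\frac{P_s}{\mu(x+\kappa_n)^2}\Big]dx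 .$$ (2) Consequently $$P_{\rm out}=1-\mu e^{\xi\nu}\Big\{\sum_{n=1}^N\tfrac{\mathcal A_n}{\mu}\big[\sigma_D^2I_{1,0}(\xi,\kappa_n,0)+\tfrac{P_s}{\mu}I_{2,0}(\xi,\kappa_n,0)\big]+\sum_{i=1}^M\ \sum_{|S|=i}(-P_s)^i\sum_{k_1+\dots+k_N=i}\frac{i!}{\prod_nk_n!}\prod_{t=1}^N\mathcal A_t^{k_t}\sum_{n=1}^N\tfrac{\mathcal A_n}{\mu}\big[\sigma_D^2I_{1,k}(\psi_S,\kappa_n,\lambda)+\tfrac{P_s}{\mu}I_{2,k}(\psi_S,\kappa_n,\lambda)\big]\Big\},$$ where $S$ runs over subsets of $\{1,\dots,M\}$ and the expression in braces equals $Y$. (3) Write, for $i\ge1$ and $p,a>0$, $$G_i(p,a)=\frac1{(i-1)!}\sum_{r=1}^{i-1}(r-1)!\,(-p)^{i-r-1}a^{-r}-\frac{(-p)^{i-1}}{(i-1)!}\,e^{pa}\,\mathrm{Ei}(-pa),\qquad \mathrm{Ei}(x)=\int_{-\infty}^x\frac{e^t}{t}\,dt\quad(x<0),$$ and, for $\ell\ge0$,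 $$J_{\ell,k}(a_1,a_2,a_3)=\sum_{i=1}^{\ell}Z_i\,G_i(a_1,a_2)+\sum_{j=1}^N\sum_{i=1}^{k_j}\Theta^{(j)}_i\,G_i(a_1,a_{3,j}),$$ $$Z_i=\frac1{(\ell-i)!}\frac{d^{\ell-i}}{dx^{\ell-i}}\prod_n(x+a_{3,n})^{-k_n}\Big|_{x=-a_2},\qquad \Theta_i^{(j)}=\frac1{(k_j-i)!}\frac{d^{k_j-i}}{dx^{k_j-i}}(x+a_2)^{-\ell}\prod_{n\ne j}(x+a_{3,n})^{-k_n}\Big|_{x=-a_{3,j}} .$$ For all $\ell,k,a_1,a_2,a_3$ as above the integral $I_{\ell,k}$ converges absolutely, and $I_{\ell,k}(a_1,a_2,a_3)=J_{\ell,k}(a_1,a_2,a_3)$ if $a_2\ne a_{3,n}$ for all $n$ with $k_n\ge1$. If $a_2=a_{3,m}$ for some $m$ with $k_m\ge1$, then $I_{\ell,k}(a_1,a_2,a_3)=J_{0,k'}(a_1,a_2,a_3)$, where $k'$ is $k$ with $k_m$ replaced by $k_m+\ell$. (4) Hence $P_{\rm out}$ equals the finite expression obtained from (2) by replacing every $I$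 with its value in (3); in particular, if $\kappa_n\neq\lambda_m$ for all $n,m$, every $I_{\ell,k}$ is replaced by $J_{\ell,k}$. -/

import Mathlib

open MeasureTheory ProbabilityTheory
open scoped NNReal

noncomputable section

/-- The law of a standard circularly-symmetric complex Gaussian variable `h` (so `E |h|² = 1`):
real and imaginary part are independent centred real Gaussians of variance `1/2`. -/
def stdComplexGaussian : Measure ℂ :=
  ((gaussianReal 0 (1 / 2 : ℝ≥0)).prod (gaussianReal 0 (1 / 2 : ℝ≥0))).map
    (fun p : ℝ × ℝ => (⟨p.1, p.2⟩ : ℂ))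

/-- The exponential integral `Ei x = ∫_{-∞}^x e^t / t dt`, for negative real `x` (the only
arguments at which it is used). -/
def expIntegralEi (x : ℝ) : ℝ := ∫ t in Set.Iio x, Real.exp t / t

/-- The numerical parameters of a network with one source, one destination, `N` jammers and `M`
eavesdroppers: the transmit power of the source, the transmit powers of the jammers, the
standard deviations of the noise at the destination and at the eavesdroppers, and the target
secrecy rate. -/
structure JammingNetwork (N M : ℕ) where
  Ps : ℝ
  P : Fin N → ℝ
  sigmaD : ℝ
  sigmaE : Fin M → ℝ
  rate : ℝ

/-- All channel coefficients as one family. A receiver is `none` (the destination) or `some m`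
(the `m`-th eavesdropper); a transmitter is `none` (the source) or `some n` (the `n`-th
jammer). -/
def channelFamily {N M : ℕ} {Ω : Type*} (hD : Ω → ℂ) (gD : Fin N → Ω → ℂ)
    (hE : Fin M → Ω → ℂ) (gE : Fin M → Fin N → Ω → ℂ) :
    Option (Fin M) × Option (Fin N) → Ω → ℂ
  | (none, none) => hD
  | (none, some n) => gD n
  | (some m, none) => hE m
  | (some m, some n) => gE m n

/-- Rayleigh fading: all channel coefficients are independent standard circularly-symmetric
complex Gaussian variables. -/
structure IsRayleighFading {N M : ℕ} {Ω : Type*} [MeasurableSpace Ω] (Pr : Measure Ω)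
    (hD : Ω → ℂ) (gD : Fin N → Ω → ℂ) (hE : Fin M → Ω → ℂ)
    (gE : Fin M → Fin N → Ω → ℂ) : Prop where
  hasLaw : ∀ c, HasLaw (channelFamily hD gD hE gE c) stdComplexGaussian Pr
  indep : iIndepFun (channelFamily hD gD hE gE) Pr

/-- The secrecy outage probability for the SINRs `γD` (destination) and `γE` (best eavesdropper)
at target rate `R`:
`Pr[log₂ ((γD+1)/(γE+1)) < R | γD > γE] ⬝ Pr[γD > γE] + Pr[γD ≤ γE]`. -/
def secrecyOutageProbability {Ω : Type*} [MeasurableSpace Ω] (Pr : Measure Ω)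
    (γD γE : Ω → ℝ) (R : ℝ) : ℝ :=
  (ProbabilityTheory.cond Pr {ω | γE ω < γD ω}).real
      {ω | Real.logb 2 ((γD ω + 1) / (γE ω + 1)) < R} * Pr.real {ω | γE ω < γD ω}
    + Pr.real {ω | γD ω ≤ γE ω}

/-- The integral `I_{ℓ,k}(a₁, a₂, a₃)
  = ∫_0^∞ exp(-a₁ x) / ((x + a₂)^ℓ ∏ₙ (x + a₃ₙ)^{kₙ}) dx`: the integrand. -/
def basicIntegrand {N : ℕ} (l : ℕ) (k : Fin N → ℕ) (a₁ a₂ : ℝ) (a₃ : Fin N → ℝ) (x : ℝ) : ℝ :=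
  Real.exp (-a₁ * x) / ((x + a₂) ^ l * ∏ n, (x + a₃ n) ^ k n)

/-- The integral `I_{ℓ,k}(a₁, a₂, a₃)`. -/
def basicIntegral {N : ℕ} (l : ℕ) (k : Fin N → ℕ) (a₁ a₂ : ℝ) (a₃ : Fin N → ℝ) : ℝ :=
  ∫ x in Set.Ioi (0 : ℝ), basicIntegrand l k a₁ a₂ a₃ x

/-- The partial-fraction coefficient `Z_i` of `(x + a₂)^{-i}`, `1 ≤ i ≤ ℓ`: the Taylor
coefficient of order `ℓ - i` at `-a₂` of `∏ₙ (x + a₃ₙ)^{-kₙ}`. -/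
def coeffZ {N : ℕ} (l : ℕ) (k : Fin N → ℕ) (a₂ : ℝ) (a₃ : Fin N → ℝ) (i : ℕ) : ℝ :=
  1 / ((l - i).factorial : ℝ) *
    iteratedDeriv (l - i) (fun x : ℝ => ∏ n, ((x + a₃ n) ^ k n)⁻¹) (-a₂)

/-- The partial-fraction coefficient `Θ_i^{(j)}` of `(x + a₃ⱼ)^{-i}`, `1 ≤ i ≤ kⱼ`: the Taylor
coefficient of order `kⱼ - i` at `-a₃ⱼ` of `(x + a₂)^{-ℓ} ∏_{n ≠ j} (x + a₃ₙ)^{-kₙ}`. -/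
def coeffTheta {N : ℕ} (l : ℕ) (k : Fin N → ℕ) (a₂ : ℝ) (a₃ : Fin N → ℝ) (j : Fin N)
    (i : ℕ) : ℝ :=
  1 / ((k j - i).factorial : ℝ) *
    iteratedDeriv (k j - i)
      (fun x : ℝ => ((x + a₂) ^ l)⁻¹ * ∏ n ∈ Finset.univ.erase j, ((x + a₃ n) ^ k n)⁻¹) (-a₃ j)

/-- The elementary expression
`(1/(i-1)!) ∑_{r=1}^{i-1} (r-1)! (-p)^{i-r-1} a^{-r} - ((-p)^{i-1}/(i-1)!) exp(p a) Ei(-p a)`. -/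
def elementaryTerm (i : ℕ) (p a : ℝ) : ℝ :=
  1 / ((i - 1).factorial : ℝ) *
      ∑ r ∈ Finset.Icc 1 (i - 1), ((r - 1).factorial : ℝ) * (-p) ^ (i - r - 1) * (a ^ r)⁻¹
    - (-p) ^ (i - 1) / ((i - 1).factorial : ℝ) * (Real.exp (p * a) * expIntegralEi (-(p * a)))

/-- The finite partial-fraction expression for `I_{ℓ,k}(a₁, a₂, a₃)`, for distinct poles. -/
def closedFormDistinct {N : ℕ} (l : ℕ) (k : Fin N → ℕ) (a₁ a₂ : ℝ) (a₃ : Fin N → ℝ) : ℝ :=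
  ∑ i ∈ Finset.Icc 1 l, coeffZ l k a₂ a₃ i * elementaryTerm i a₁ a₂
    + ∑ j, ∑ i ∈ Finset.Icc 1 (k j), coeffTheta l k a₂ a₃ j i * elementaryTerm i a₁ (a₃ j)

open Classical in
/-- The finite expression for `I_{ℓ,k}(a₁, a₂, a₃)` in general: if `a₂` equals some `a₃ₘ` with
`kₘ ≥ 1`, the factor `(x + a₂)^ℓ` is absorbed into `(x + a₃ₘ)^{kₘ}`. -/
def closedForm {N : ℕ} (l : ℕ) (k : Fin N → ℕ) (a₁ a₂ : ℝ) (a₃ : Fin N → ℝ) : ℝ :=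
  if ∃ m, 0 < k m ∧ a₂ = a₃ m then
    closedFormDistinct 0 (fun n => if 0 < k n ∧ a₂ = a₃ n then k n + l else k n) a₁ a₂ a₃
  else closedFormDistinct l k a₁ a₂ a₃

namespace JammingNetwork

variable {N M : ℕ} (net : JammingNetwork N M)

/-- SINR at a receiver with noise standard deviation `σ`, source channel `h` and jammer
channels `g`. -/
def sinr (σ : ℝ) (h : ℂ) (g : Fin N → ℂ) : ℝ :=
  net.Ps * ‖h‖ ^ 2 / (∑ n, net.P n * ‖g n‖ ^ 2 + σ ^ 2)

/-- SINR at the destination. -/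
def gammaD {Ω : Type*} (hD : Ω → ℂ) (gD : Fin N → Ω → ℂ) (ω : Ω) : ℝ :=
  net.sinr net.sigmaD (hD ω) (fun n => gD n ω)

/-- Largest SINR among the eavesdroppers (a maximum over a finite set, non-empty for `M ≥ 1`). -/
def gammaEmax {Ω : Type*} (hE : Fin M → Ω → ℂ) (gE : Fin M → Fin N → Ω → ℂ) (ω : Ω) : ℝ :=
  ⨆ m, net.sinr (net.sigmaE m) (hE m ω) (fun n => gE m n ω)

/-- `μ = 2^R`. -/
def mu : ℝ := (2 : ℝ) ^ net.rate

/-- `ν = 2^{-R} - 1`. -/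
def nu : ℝ := (2 : ℝ) ^ (-net.rate) - 1

/-- `A_n = [P_n ∏_{j ≠ n} (1 - P_j / P_n)]⁻¹`. -/
def A (n : Fin N) : ℝ :=
  (net.P n * ∏ j ∈ Finset.univ.erase n, (1 - net.P j / net.P n))⁻¹

/-- `ξ = σ_D² μ / P_s`. -/
def xi : ℝ := net.sigmaD ^ 2 * net.mu / net.Ps

/-- `κ_n = P_s / (μ P_n) - ν`. -/
def kappa (n : Fin N) : ℝ := net.Ps / (net.mu * net.P n) - net.nu

/-- `λ_n = P_s / P_n`. -/
def lam (n : Fin N) : ℝ := net.Ps / net.P n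

/-- `ψ_S = ξ + P_s⁻¹ ∑_{j ∈ S} σ_{E_j}²` for a set `S` of eavesdroppers. -/
def psi (S : Finset (Fin M)) : ℝ := net.xi + (∑ j ∈ S, net.sigmaE j ^ 2) / net.Ps

/-- The integrand of the single-integral form of the outage probability. -/
def integrandY (x : ℝ) : ℝ :=
  (∏ i, (1 - net.Ps * Real.exp (-(net.sigmaE i ^ 2 * x / net.Ps)) *
      ∑ n, net.A n / (x + net.lam n)))
    * Real.exp (-net.xi * x)
    * ∑ n, net.A n / net.mu *
        (net.sigmaD ^ 2 / (x + net.kappa n) + net.Ps / (net.mu * (x + net.kappa n) ^ 2))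

/-- The integral `Y`. -/
def Y : ℝ := ∫ x in Set.Ioi (0 : ℝ), net.integrandY x

/-- The finite multinomial expansion of `Y`, with a function `I` in the role of the integrals
`I_{ℓ,k}(a₁, a₂, a₃)`. -/
def expansionY (I : ℕ → (Fin N → ℕ) → ℝ → ℝ → (Fin N → ℝ) → ℝ) : ℝ :=
  ∑ n, net.A n / net.mu *
      (net.sigmaD ^ 2 * I 1 0 net.xi (net.kappa n) 0
        + net.Ps / net.mu * I 2 0 net.xi (net.kappa n) 0)
  + ∑ i ∈ Finset.Icc 1 M, ∑ S ∈ (Finset.univ : Finset (Fin M)).powersetCard i,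
      (-net.Ps) ^ i *
      ∑ k ∈ (Finset.univ : Finset (Fin N)).piAntidiag i,
        (i.factorial : ℝ) / (∏ n, ((k n).factorial : ℝ)) * (∏ t, net.A t ^ k t) *
        ∑ n, net.A n / net.mu *
          (net.sigmaD ^ 2 * I 1 k (net.psi S) (net.kappa n) net.lam
            + net.Ps / net.mu * I 2 k (net.psi S) (net.kappa n) net.lam)

end JammingNetwork

end

/-! Since `μ > 1`, the event `γ_D ≥ μ (γ_Emax + 1) - 1` lies inside `γ_D > γ_Emax`, so the
conditioning cancels and outage is exactly its complement (`secrecyOutageProbability_eq`). The event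
says that `γ_D / μ + ν ≥ γ_Emax`.

At one receiver `|h|²` is exponential with mean 1. Conditionally on the jammer gains the SINR has an
exponential tail, and averaging over the independent gains multiplies Laplace transforms
(`receiverLaw_le_sinr`). Distinct jammer powers turn the resulting product into a sum over simple
poles (`prod_eq_sum_A`). Differentiating the tail of `γ_D / μ + ν` gives its density on `(0, ∞)`;
independence makes the distribution function of `γ_Emax` a product. Tonelli combines the two into
the integral `Y` (`receiverLaw_prod_pi_no_outage`).

Expanding the product over sets of eavesdroppers and the powers by the multinomial theorem is a
pointwise identity (`integrandY_eq_expansionY`), which is integrated term by term. Each `I_{ℓ,k}` is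
then split by partial fractions whose coefficients are Taylor coefficients (`partialFraction`),
leaving `∫ exp(-p x) (x + a)^{-i}`. Integration by parts lowers `i` down to 1, where the integral is
an `Ei` value. Coinciding poles are merged before the decomposition (`basicIntegral_eq_closedForm`).
-/

noncomputable section

/-! ### Partial fractions with several multiple poles -/

/-- Taylor coefficients of `∑_{j<m} c_j (x-x₀)^j + (x-x₀)^m g(x)` below order `m`. -/
theorem iteratedDeriv_sum_pow_add_pow_mul {m : ℕ} (c : ℕ → ℝ) {f g : ℝ → ℝ} {x₀ : ℝ}
    (hg : AnalyticAt ℝ g x₀)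
    (hf : ∀ᶠ x in nhds x₀, f x = ∑ j ∈ Finset.range m, c j * (x - x₀) ^ j + (x - x₀) ^ m * g x)
    {i : ℕ} (hi : i < m) : iteratedDeriv i f x₀ = i.factorial * c i := by
  rw [Filter.EventuallyEq.iteratedDeriv_eq i hf]
  have hpow : ∀ j, iteratedDeriv i (fun x : ℝ => (x - x₀) ^ j) x₀
      = if i = j then (j.factorial : ℝ) else 0 := by
    intro j
    have h := congrFun (iteratedDeriv_comp_add_const i (fun x : ℝ => x ^ j) (-x₀)) x₀
    simp only [← sub_eq_add_neg, sub_self] at h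
    rw [h, iteratedDeriv_fun_pow_zero]
    split_ifs <;> simp
  have hrest : iteratedDeriv i (fun x : ℝ => (x - x₀) ^ m * g x) x₀ = 0 := by
    have han : AnalyticAt ℝ (fun x : ℝ => (x - x₀) ^ m * g x) x₀ := by fun_prop
    refine (natCast_le_analyticOrderAt_iff_iteratedDeriv_eq_zero han).1 ?_ i hi
    rw [natCast_le_analyticOrderAt han]
    exact ⟨g, hg, Filter.Eventually.of_forall fun x => by simp⟩
  have hA : ∀ j ∈ Finset.range m, ContDiffAt ℝ i (fun x : ℝ => c j * (x - x₀) ^ j) x₀ :=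
    fun j _ => by fun_prop
  have hB : ContDiffAt ℝ i (fun x : ℝ => (x - x₀) ^ m * g x) x₀ :=
    ContDiffAt.mul (by fun_prop) hg.contDiffAt
  rw [iteratedDeriv_fun_add (ContDiffAt.sum hA) hB, hrest, iteratedDeriv_fun_sum hA]
  simp only [iteratedDeriv_const_mul_field, hpow]
  simp [hi, mul_comm]

-- Dividing the polynomial 1 by pairwise coprime powers of linear factors gives an expansion with
-- unknown constants and a polynomial part. Decay at infinity kills the polynomial part; clearing
-- the denominator at one pole identifies its constants as Taylor coefficients of the other factors.
-- Nonemptiness of `s` is essential: the empty product 1 does not decay.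
open Polynomial in
theorem partialFraction_finset {ι : Type*} [DecidableEq ι] (s : Finset ι) (hs : s.Nonempty)
    (n : ι → ℕ) (hn : ∀ i ∈ s, 0 < n i) (b : ι → ℝ) (hb : Set.InjOn b s)
    (x : ℝ) (hx : ∀ i ∈ s, x + b i ≠ 0) :
    ∏ i ∈ s, ((x + b i) ^ n i)⁻¹ = ∑ i ∈ s, ∑ r ∈ Finset.Icc 1 (n i),
      (1 / ((n i - r).factorial : ℝ) * iteratedDeriv (n i - r)
        (fun y : ℝ => ∏ k ∈ s.erase i, ((y + b k) ^ n k)⁻¹) (-b i)) * ((x + b i) ^ r)⁻¹ := by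
  obtain ⟨q, r, hr, h1⟩ := eq_quo_mul_prod_pow_add_sum_rem_mul_prod_pow (s := s) (1 : ℝ[X])
    (g := fun i => X - C (-b i)) (fun i _ => monic_X_sub_C _)
    (fun i hi j hj hij => isCoprime_X_sub_C_of_isUnit_sub
      (sub_ne_zero.2 fun h => hij (hb hi hj (neg_injective h))).isUnit) n
  -- Remainders modulo a linear polynomial are constants. The default 0 is never used, as only
  -- indices below `n i` occur.
  set c : ι → ℕ → ℝ := fun i j => if h : j < n i then (r i ⟨j, h⟩).coeff 0 else 0 with hc
  have hrc : ∀ i ∈ s, ∀ j : Fin (n i), r i j = C (c i j) := by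
    intro i hi j
    have hd := hr i hi j
    rw [degree_X_sub_C] at hd
    simp only [hc, j.2, dif_pos]
    exact eq_C_of_degree_le_zero ((degree_le_iff_coeff_zero _ _).2 fun m hm =>
      (degree_lt_iff_coeff_zero _ 1).1 hd m (Nat.one_le_iff_ne_zero.2 fun h => by simp [h] at hm))
  have hev : ∀ y : ℝ, 1 = q.eval y * ∏ i ∈ s, (y + b i) ^ n i
      + ∑ i ∈ s, (∑ j ∈ Finset.range (n i), c i j * (y + b i) ^ j)
        * ∏ k ∈ s.erase i, (y + b k) ^ n k := by
    intro y
    have := congrArg (Polynomial.eval y) h1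
    rw [eval_one] at this
    rw [this]
    simp only [eval_add, eval_mul, eval_prod, eval_pow, eval_sub, eval_X, eval_C, eval_finsetSum,
      sub_neg_eq_add]
    congr 1
    refine Finset.sum_congr rfl fun i hi => ?_
    rw [Finset.sum_mul, ← Fin.sum_univ_eq_sum_range
      (fun j => c i j * (y + b i) ^ j * ∏ k ∈ s.erase i, (y + b k) ^ n k)]
    exact Finset.sum_congr rfl fun j _ => by rw [hrc i hi j, eval_C]
  have hdiv : ∀ y : ℝ, (∀ i ∈ s, y + b i ≠ 0) → ∏ i ∈ s, ((y + b i) ^ n i)⁻¹ = q.eval y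
      + ∑ i ∈ s, ∑ r ∈ Finset.Icc 1 (n i), c i (n i - r) * ((y + b i) ^ r)⁻¹ := by
    intro y hy
    have hne : ∏ i ∈ s, (y + b i) ^ n i ≠ 0 :=
      Finset.prod_ne_zero_iff.2 fun i hi => pow_ne_zero _ (hy i hi)
    rw [Finset.prod_inv_distrib, inv_eq_one_div, div_eq_iff hne, add_mul]
    conv_lhs => rw [hev y]
    congr 1
    rw [Finset.sum_mul]
    refine Finset.sum_congr rfl fun i hi => ?_
    rw [← Finset.mul_prod_erase s _ hi, ← mul_assoc]
    congr 1
    -- Reindexing by `r = n i - j`: the constant of `(y + b i)^j` in the numerator becomes that of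
    -- the pole of order `r`.
    rw [Finset.sum_mul, ← Finset.sum_range_reflect, Finset.range_eq_Ico,
      Finset.sum_Ico_add' (fun r => c i (n i - r) * (y + b i) ^ (n i - r)) 0 (n i) 1 |>.symm.trans
        (Finset.sum_congr rfl fun j hj => by rw [Nat.sub_sub, add_comm 1 j]) |>.symm]
    rw [show Finset.Ico (0 + 1) (n i + 1) = Finset.Icc 1 (n i) by ext; simp]
    refine Finset.sum_congr rfl fun r hr => ?_
    rw [Finset.mem_Icc] at hr
    have : (y + b i) ^ n i = (y + b i) ^ (n i - r) * (y + b i) ^ r := by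
      rw [← pow_add, Nat.sub_add_cancel hr.2]
    rw [this]
    have := pow_ne_zero r (hy i hi)
    field_simp
  have hinv : ∀ (i : ι) (r : ℕ), 1 ≤ r →
      Filter.Tendsto (fun y : ℝ => ((y + b i) ^ r)⁻¹) Filter.atTop (nhds 0) := fun i r hr =>
    ((Filter.tendsto_pow_atTop (by omega)).comp
      (Filter.tendsto_atTop_add_const_right _ _ Filter.tendsto_id)).inv_tendsto_atTop
  -- Both the product and the polar sums tend to 0 at infinity, hence so does the polynomial `q`;
  -- this forces its leading coefficient to vanish.
  have hq : q = 0 := by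
    have hlim : Filter.Tendsto (fun y => q.eval y) Filter.atTop (nhds 0) := by
      have h2 : Filter.Tendsto (fun y : ℝ => ∏ i ∈ s, ((y + b i) ^ n i)⁻¹
          - ∑ i ∈ s, ∑ r ∈ Finset.Icc 1 (n i), c i (n i - r) * ((y + b i) ^ r)⁻¹)
          Filter.atTop (nhds 0) := by
        have hp := tendsto_finsetProd s fun i hi => hinv i (n i) (hn i hi)
        have hsum := tendsto_finsetSum s fun i _ => tendsto_finsetSum (Finset.Icc 1 (n i))
          fun r hr => (hinv i r (Finset.mem_Icc.1 hr).1).const_mul (c i (n i - r))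
        obtain ⟨i₀, hi₀⟩ := hs
        have := hp.sub hsum
        simpa [Finset.prod_eq_zero hi₀] using this
      refine h2.congr' ?_
      have hev' : ∀ᶠ y : ℝ in Filter.atTop, ∀ i ∈ s, y + b i ≠ 0 := by
        rw [Filter.eventually_all_finset]
        intro i _
        filter_upwards [Filter.eventually_gt_atTop (-b i)] with y hy
        linarith
      filter_upwards [hev'] with y hy
      rw [hdiv y hy]; ring
    exact leadingCoeff_eq_zero.1 ((Polynomial.tendsto_nhds_iff q).1 hlim).1
  rw [hdiv x hx, hq, eval_zero, zero_add]
  refine Finset.sum_congr rfl fun i hi => Finset.sum_congr rfl fun r hr => ?_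
  rw [Finset.mem_Icc] at hr
  congr 1
  have hne : ∀ k ∈ s.erase i, -b i + b k ≠ 0 := fun k hk h => by
    rw [Finset.mem_erase] at hk
    exact hk.1 (hb hk.2 hi (by linarith))
  -- Dividing `hev` by the factors at the other poles leaves the numerator at `-b i` plus a
  -- remainder vanishing there to order `n i`; `g` is the analytic cofactor of that remainder.
  have key := iteratedDeriv_sum_pow_add_pow_mul (m := n i) (c i)
    (f := fun y : ℝ => ∏ k ∈ s.erase i, ((y + b k) ^ n k)⁻¹)
    (g := fun y : ℝ => (∏ k ∈ s.erase i, ((y + b k) ^ n k)⁻¹) * ∑ k ∈ s.erase i,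
      (∑ j ∈ Finset.range (n k), c k j * (y + b k) ^ j)
        * ∏ l ∈ (s.erase i).erase k, (y + b l) ^ n l) (x₀ := -b i)
    ?_ ?_ (i := n i - r) (by omega)
  · rw [key]
    field_simp
  · refine AnalyticAt.mul (Finset.analyticAt_fun_prod _ fun k hk => ?_) (by fun_prop)
    exact AnalyticAt.inv (by fun_prop) (pow_ne_zero _ (hne k hk))
  · have hev' : ∀ᶠ y : ℝ in nhds (-b i), ∀ k ∈ s.erase i, y + b k ≠ 0 := by
      rw [Filter.eventually_all_finset]
      intro k hk
      exact ContinuousAt.eventually_ne (by fun_prop) (hne k hk)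
    filter_upwards [hev'] with y hy
    have hP : ∏ k ∈ s.erase i, (y + b k) ^ n k ≠ 0 :=
      Finset.prod_ne_zero_iff.2 fun k hk => pow_ne_zero _ (hy k hk)
    have h := hev y
    rw [hq, eval_zero, zero_mul, zero_add, ← Finset.add_sum_erase s _ hi] at h
    have hrw : ∀ k ∈ s.erase i, ∏ l ∈ s.erase k, (y + b l) ^ n l
        = (y + b i) ^ n i * ∏ l ∈ (s.erase i).erase k, (y + b l) ^ n l := by
      intro k hk
      rw [Finset.erase_right_comm]
      exact (Finset.mul_prod_erase (s.erase k) (fun l => (y + b l) ^ n l)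
        (Finset.mem_erase.2 ⟨(Finset.ne_of_mem_erase hk).symm, hi⟩)).symm
    have hsum : ∑ k ∈ s.erase i, (∑ j ∈ Finset.range (n k), c k j * (y + b k) ^ j)
          * ∏ l ∈ s.erase k, (y + b l) ^ n l
        = (y + b i) ^ n i * ∑ k ∈ s.erase i, (∑ j ∈ Finset.range (n k), c k j * (y + b k) ^ j)
          * ∏ l ∈ (s.erase i).erase k, (y + b l) ^ n l := by
      rw [Finset.mul_sum]
      exact Finset.sum_congr rfl fun k hk => by rw [hrw k hk, mul_left_comm]
    rw [hsum] at h
    simp only [sub_neg_eq_add]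
    rw [Finset.prod_inv_distrib]
    set P := ∏ k ∈ s.erase i, (y + b k) ^ n k
    calc P⁻¹ = P⁻¹ * 1 := (mul_one _).symm
      _ = _ := by
        conv_lhs => rw [h]
        rw [mul_add, mul_comm _ P, ← mul_assoc P⁻¹ P, inv_mul_cancel₀ hP]
        ring

/-- Partial fraction decomposition of `∏ i, (x + b i)^{-n i}` with Taylor coefficients. -/
theorem partialFraction {ι : Type*} [Fintype ι] [DecidableEq ι] (n : ι → ℕ) (b : ι → ℝ)
    (hne : ∃ i, 0 < n i) (hb : ∀ i j, i ≠ j → 0 < n i → 0 < n j → b i ≠ b j)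
    (x : ℝ) (hx : ∀ i, 0 < n i → x + b i ≠ 0) :
    ∏ i, ((x + b i) ^ n i)⁻¹ = ∑ i, ∑ r ∈ Finset.Icc 1 (n i),
      (1 / ((n i - r).factorial : ℝ) * iteratedDeriv (n i - r)
        (fun y : ℝ => ∏ k ∈ Finset.univ.erase i, ((y + b k) ^ n k)⁻¹) (-b i))
        * ((x + b i) ^ r)⁻¹ := by
  obtain ⟨i₀, hi₀⟩ := hne
  have hmem : ∀ i, i ∈ Finset.univ.filter (fun i => 0 < n i) ↔ 0 < n i := by simp
  have h := partialFraction_finset (Finset.univ.filter fun i => 0 < n i) ⟨i₀, (hmem _).2 hi₀⟩ n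
    (fun i hi => (hmem i).1 hi) b
    (fun i hi j hj hij => by
      by_contra hne
      exact hb i j hne ((hmem i).1 hi) ((hmem j).1 hj) hij) x
    (fun i hi => hx i ((hmem i).1 hi))
  -- Indices of exponent 0 contribute factors 1 and empty sums, so their `b i` may collide freely.
  rw [← Finset.prod_subset (Finset.subset_univ (Finset.univ.filter fun i => 0 < n i)), h,
    ← Finset.sum_subset (Finset.subset_univ (Finset.univ.filter fun i => 0 < n i))]
  · refine Finset.sum_congr rfl fun i _ => Finset.sum_congr rfl fun r _ => ?_
    congr 3
    funext y
    refine Finset.prod_subset (Finset.erase_subset_erase _ (Finset.subset_univ _)) ?_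
    intro k hk hk'
    have : n k = 0 := by
      by_contra h0
      exact hk' (Finset.mem_erase.2 ⟨Finset.ne_of_mem_erase hk, (hmem k).2 (by omega)⟩)
    simp [this]
  · intro i _ hi
    have : n i = 0 := by simpa using hi
    simp [this]
  · intro i _ hi
    have : n i = 0 := by simpa using hi
    simp [this]

/-! ### Evaluation of the integrals `I_{ℓ,k}` -/

theorem integrableOn_basicIntegrand {N : ℕ} (l : ℕ) (k : Fin N → ℕ) {a₁ a₂ : ℝ} {a₃ : Fin N → ℝ}
    (h₁ : 0 < a₁) (h₂ : 0 < l → 0 < a₂) (h₃ : ∀ n, 0 < k n → 0 < a₃ n) :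
    IntegrableOn (basicIntegrand l k a₁ a₂ a₃) (Set.Ioi 0) := by
  have hexp : IntegrableOn (fun x : ℝ => Real.exp (-a₁ * x) / (a₂ ^ l * ∏ n, a₃ n ^ k n))
      (Set.Ioi 0) := (integrableOn_exp_mul_Ioi (neg_lt_zero.2 h₁) 0).div_const _
  have hpow : ∀ {a : ℝ} {m : ℕ}, (0 < m → 0 < a) → 0 < a ^ m := by
    intro a m h
    rcases Nat.eq_zero_or_pos m with rfl | hm
    · simp
    · exact pow_pos (h hm) _
  have hle : ∀ {a x : ℝ} {m : ℕ}, (0 < m → 0 < a) → 0 < x → a ^ m ≤ (x + a) ^ m := by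
    intro a x m h hx
    rcases Nat.eq_zero_or_pos m with rfl | hm
    · simp
    · exact pow_le_pow_left₀ (h hm).le (by linarith) _
  refine hexp.mono' (Measurable.aestronglyMeasurable ?_) ?_
  · unfold basicIntegrand
    fun_prop
  · refine (ae_restrict_iff' measurableSet_Ioi).2 (Filter.Eventually.of_forall fun x hx => ?_)
    have hx : (0 : ℝ) < x := hx
    have hpos : 0 < a₂ ^ l * ∏ n, a₃ n ^ k n :=
      mul_pos (hpow h₂) (Finset.prod_pos fun n _ => hpow (h₃ n))
    have hmono : a₂ ^ l * ∏ n, a₃ n ^ k n ≤ (x + a₂) ^ l * ∏ n, (x + a₃ n) ^ k n := by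
      refine mul_le_mul (hle h₂ hx) ?_ (Finset.prod_nonneg fun n _ => (hpow (h₃ n)).le)
        ((hpow h₂).le.trans (hle h₂ hx))
      exact Finset.prod_le_prod (fun n _ => (hpow (h₃ n)).le) fun n _ => hle (h₃ n) hx
    rw [basicIntegrand, Real.norm_of_nonneg (div_nonneg (Real.exp_pos _).le
      (hpos.le.trans hmono))]
    gcongr

theorem integrableOn_exp_mul_inv_pow (i : ℕ) {p a : ℝ} (hp : 0 < p) (ha : 0 < a) :
    IntegrableOn (fun x : ℝ => Real.exp (-p * x) * ((x + a) ^ i)⁻¹) (Set.Ioi 0) := by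
  have h := integrableOn_basicIntegrand (N := 0) i (fun _ => 0) (a₃ := fun _ => 0) hp
    (fun _ => ha) (fun n => n.elim0)
  refine h.congr_fun (fun x _ => ?_) measurableSet_Ioi
  simp [basicIntegrand, div_eq_mul_inv]

theorem expIntegralEi_neg {p a : ℝ} (hp : 0 < p) :
    expIntegralEi (-(p * a))
      = -(Real.exp (-(p * a)) * ∫ x in Set.Ioi (0 : ℝ), Real.exp (-p * x) * ((x + a) ^ 1)⁻¹) := by
  -- The substitution `t = -p (x + a)` carries the half-line to the range of integration of `Ei (-p
  -- a)`.
  have himg : (fun x : ℝ => -p * (x + a)) '' Set.Ioi 0 = Set.Iio (-(p * a)) := by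
    ext y
    simp only [Set.mem_image, Set.mem_Ioi, Set.mem_Iio]
    constructor
    · rintro ⟨x, hx, rfl⟩
      nlinarith
    · intro hy
      refine ⟨-y / p - a, ?_, by field_simp; ring⟩
      rw [sub_pos, lt_div_iff₀ hp]
      linarith
  have h := integral_image_eq_integral_abs_deriv_smul (s := Set.Ioi (0 : ℝ))
    (f := fun x : ℝ => -p * (x + a)) (f' := fun _ => -p) measurableSet_Ioi
    (fun x _ => by
      simpa using (((hasDerivAt_id x).add_const a).const_mul (-p)).hasDerivWithinAt)
    (fun x _ y _ hxy => by
      have : p * (x - y) = 0 := by simp only at hxy; linarith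
      rcases mul_eq_zero.1 this with h | h <;> linarith)
    (fun t => Real.exp t / t)
  rw [himg] at h
  rw [expIntegralEi, h, ← integral_const_mul, ← integral_neg]
  congr 1
  funext x
  rw [abs_neg, abs_of_pos hp, smul_eq_mul, show -p * (x + a) = -(p * a) + -p * x by ring,
    Real.exp_add, show -(p * a) + -p * x = -(p * (x + a)) by ring, div_neg, ← div_div, pow_one,
    mul_neg, div_eq_mul_inv, div_eq_mul_inv]
  field_simp

/-- Integration by parts, obtained by integrating the derivative of `exp(-p x) (x + a)^{-(i+1)}`
over the half-line. `elementaryTerm_succ` is the matching recursion for the closed form. -/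
theorem integral_exp_mul_inv_pow_succ (i : ℕ) {p a : ℝ} (hp : 0 < p) (ha : 0 < a) :
    ((i : ℝ) + 1) * ∫ x in Set.Ioi (0 : ℝ), Real.exp (-p * x) * ((x + a) ^ (i + 2))⁻¹
      = (a ^ (i + 1))⁻¹
        - p * ∫ x in Set.Ioi (0 : ℝ), Real.exp (-p * x) * ((x + a) ^ (i + 1))⁻¹ := by
  have hderiv : ∀ x : ℝ, 0 ≤ x → HasDerivAt
      (fun x : ℝ => Real.exp (-p * x) * ((x + a) ^ (i + 1))⁻¹)
      (-p * (Real.exp (-p * x) * ((x + a) ^ (i + 1))⁻¹)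
        - ((i : ℝ) + 1) * (Real.exp (-p * x) * ((x + a) ^ (i + 2))⁻¹)) x := by
    intro x hx
    have hxa : x + a ≠ 0 := by positivity
    have h1 : HasDerivAt (fun x : ℝ => Real.exp (-p * x)) (Real.exp (-p * x) * (-p)) x := by
      simpa using ((hasDerivAt_id x).const_mul (-p)).exp
    have h2 := (((hasDerivAt_id x).add_const a).pow (i + 1)).inv (pow_ne_zero _ hxa)
    refine (h1.mul h2).congr_deriv ?_
    simp only [id, Nat.cast_add, Nat.cast_one, Nat.add_sub_cancel, Pi.pow_apply, Pi.inv_apply]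
    field_simp
    ring
  have hI1 := (integrableOn_exp_mul_inv_pow (i + 1) hp ha).const_mul (-p)
  have hI2 := (integrableOn_exp_mul_inv_pow (i + 2) hp ha).const_mul ((i : ℝ) + 1)
  have hlim : Filter.Tendsto (fun x : ℝ => Real.exp (-p * x) * ((x + a) ^ (i + 1))⁻¹)
      Filter.atTop (nhds 0) := by
    have h1 : Filter.Tendsto (fun x : ℝ => Real.exp (-p * x)) Filter.atTop (nhds 0) :=
      Real.tendsto_exp_atBot.comp (Filter.tendsto_id.const_mul_atTop_of_neg (neg_lt_zero.2 hp))
    have h2 : Filter.Tendsto (fun x : ℝ => ((x + a) ^ (i + 1))⁻¹) Filter.atTop (nhds 0) :=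
      ((Filter.tendsto_pow_atTop (by omega)).comp
        (Filter.tendsto_atTop_add_const_right _ _ Filter.tendsto_id)).inv_tendsto_atTop
    simpa using h1.mul h2
  have h := integral_Ioi_of_hasDerivAt_of_tendsto
    (hderiv 0 le_rfl).continuousAt.continuousWithinAt (fun x hx => hderiv x (le_of_lt hx))
    (hI1.sub hI2) hlim
  rw [integral_sub hI1 hI2, integral_const_mul, integral_const_mul] at h
  simp only [mul_zero, Real.exp_zero, zero_add, one_mul, zero_sub] at h
  linarith

theorem elementaryTerm_succ (i : ℕ) (p a : ℝ) :
    ((i : ℝ) + 1) * elementaryTerm (i + 2) p a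
      = (a ^ (i + 1))⁻¹ - p * elementaryTerm (i + 1) p a := by
  have hf : ((i + 1).factorial : ℝ) = ((i : ℝ) + 1) * i.factorial := by
    rw [Nat.factorial_succ]; push_cast; ring
  have hi : (i.factorial : ℝ) ≠ 0 := Nat.cast_ne_zero.2 i.factorial_ne_zero
  have hsum : ∑ r ∈ Finset.Icc 1 (i + 1),
        ((r - 1).factorial : ℝ) * (-p) ^ (i + 2 - r - 1) * (a ^ r)⁻¹
      = -p * (∑ r ∈ Finset.Icc 1 i,
        ((r - 1).factorial : ℝ) * (-p) ^ (i + 1 - r - 1) * (a ^ r)⁻¹)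
        + i.factorial * (a ^ (i + 1))⁻¹ := by
    rw [Finset.sum_Icc_succ_top (by omega), Finset.mul_sum]
    congr 1
    · refine Finset.sum_congr rfl fun r hr => ?_
      rw [Finset.mem_Icc] at hr
      rw [show i + 2 - r - 1 = (i + 1 - r - 1) + 1 by omega, pow_succ]
      ring
    · simp
  simp only [elementaryTerm, Nat.add_sub_cancel, show i + 2 - 1 = i + 1 by omega]
  rw [hsum, hf, pow_succ]
  have : (i : ℝ) + 1 ≠ 0 := by positivity
  field_simp
  ring

theorem integral_exp_mul_inv_pow_eq_elementaryTerm (i : ℕ) {p a : ℝ} (hp : 0 < p) (ha : 0 < a) :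
    ∫ x in Set.Ioi (0 : ℝ), Real.exp (-p * x) * ((x + a) ^ (i + 1))⁻¹
      = elementaryTerm (i + 1) p a := by
  induction i with
  | zero =>
    simp only [elementaryTerm, zero_add, expIntegralEi_neg hp]
    rw [mul_neg, ← mul_assoc, ← Real.exp_add]
    simp
  | succ i ih =>
    have h1 := integral_exp_mul_inv_pow_succ i hp ha
    have h2 := elementaryTerm_succ i p a
    rw [ih, ← h2] at h1
    exact mul_left_cancel₀ (by positivity) h1

/-- The conditions on `a₂` are required only for `0 < l`, so that the case `l = 0` serves for merged
poles. `hne` guarantees at least one pole. -/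
theorem basicIntegral_eq_closedFormDistinct {N : ℕ} (l : ℕ) (k : Fin N → ℕ) {a₁ a₂ : ℝ}
    {a₃ : Fin N → ℝ} (h₁ : 0 < a₁) (h₂ : 0 < l → 0 < a₂) (h₃ : ∀ n, 0 < k n → 0 < a₃ n)
    (h₃₃ : ∀ n m, n ≠ m → 0 < k n → 0 < k m → a₃ n ≠ a₃ m)
    (h₂₃ : 0 < l → ∀ n, 0 < k n → a₂ ≠ a₃ n) (hne : 0 < l ∨ ∃ n, 0 < k n) :
    basicIntegral l k a₁ a₂ a₃ = closedFormDistinct l k a₁ a₂ a₃ := by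
  have hpf : ∀ x ∈ Set.Ioi (0 : ℝ), basicIntegrand l k a₁ a₂ a₃ x
      = ∑ i ∈ Finset.Icc 1 l, coeffZ l k a₂ a₃ i * (Real.exp (-a₁ * x) * ((x + a₂) ^ i)⁻¹)
        + ∑ j, ∑ i ∈ Finset.Icc 1 (k j),
          coeffTheta l k a₂ a₃ j i * (Real.exp (-a₁ * x) * ((x + a₃ j) ^ i)⁻¹) := by
    intro x hx
    have hx : (0 : ℝ) < x := hx
    -- All poles form one family: `none` stands for `a₂`, `some n` for `a₃ n`.
    have h := partialFraction (ι := Option (Fin N)) (fun o => o.elim l k) (fun o => o.elim a₂ a₃)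
      (by
        rcases hne with h | ⟨n, h⟩
        · exact ⟨none, h⟩
        · exact ⟨some n, h⟩)
      (by
        rintro (_ | i) (_ | j) hij hi hj
        · exact absurd rfl hij
        · exact h₂₃ hi j hj
        · exact (h₂₃ hj i hi).symm
        · exact h₃₃ i j (fun h => hij (congrArg some h)) hi hj) x
      (by
        rintro (_ | i) hi
        · exact (add_pos hx (h₂ hi)).ne'
        · exact (add_pos hx (h₃ i hi)).ne')
    have he1 : (Finset.univ : Finset (Option (Fin N))).erase none
        = Finset.univ.map Function.Embedding.some := by
      ext (_ | i) <;> simp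
    have he2 : ∀ j : Fin N, (Finset.univ : Finset (Option (Fin N))).erase (some j)
        = Finset.insertNone (Finset.univ.erase j) := by
      intro j
      ext (_ | i) <;> simp
    rw [Fintype.prod_option, Fintype.sum_option] at h
    simp only [he1, he2, Finset.prod_map, Finset.prod_insertNone, Option.elim,
      Function.Embedding.some_apply] at h
    rw [basicIntegrand, div_eq_mul_inv, mul_inv, ← Finset.prod_inv_distrib, h, mul_add,
      Finset.mul_sum, Finset.mul_sum]
    congr 1
    · exact Finset.sum_congr rfl fun i _ => by rw [coeffZ]; ring
    · refine Finset.sum_congr rfl fun j _ => ?_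
      rw [Finset.mul_sum]
      exact Finset.sum_congr rfl fun i _ => by rw [coeffTheta]; ring
  have hterm : ∀ (i : ℕ) (a : ℝ), 1 ≤ i → 0 < a →
      ∫ x in Set.Ioi (0 : ℝ), Real.exp (-a₁ * x) * ((x + a) ^ i)⁻¹ = elementaryTerm i a₁ a := by
    intro i a hi ha
    obtain ⟨i, rfl⟩ := Nat.exists_eq_add_of_le' hi
    exact integral_exp_mul_inv_pow_eq_elementaryTerm i h₁ ha
  have hZ : ∀ i ∈ Finset.Icc 1 l, 1 ≤ i ∧ 0 < a₂ := fun i hi =>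
    ⟨(Finset.mem_Icc.1 hi).1, h₂ ((Finset.mem_Icc.1 hi).1.trans (Finset.mem_Icc.1 hi).2)⟩
  have hT : ∀ j, ∀ i ∈ Finset.Icc 1 (k j), 1 ≤ i ∧ 0 < a₃ j := fun j i hi =>
    ⟨(Finset.mem_Icc.1 hi).1, h₃ j ((Finset.mem_Icc.1 hi).1.trans (Finset.mem_Icc.1 hi).2)⟩
  have hIZ : ∀ i ∈ Finset.Icc 1 l, IntegrableOn (fun x : ℝ =>
      coeffZ l k a₂ a₃ i * (Real.exp (-a₁ * x) * ((x + a₂) ^ i)⁻¹)) (Set.Ioi 0) := fun i hi =>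
    (integrableOn_exp_mul_inv_pow i h₁ (hZ i hi).2).const_mul _
  have hIT : ∀ j, ∀ i ∈ Finset.Icc 1 (k j), IntegrableOn (fun x : ℝ =>
      coeffTheta l k a₂ a₃ j i * (Real.exp (-a₁ * x) * ((x + a₃ j) ^ i)⁻¹)) (Set.Ioi 0) :=
    fun j i hi => (integrableOn_exp_mul_inv_pow i h₁ (hT j i hi).2).const_mul _
  rw [basicIntegral, setIntegral_congr_fun measurableSet_Ioi hpf, integral_add
    (integrable_finsetSum _ hIZ)
    (integrable_finsetSum _ fun j _ => integrable_finsetSum _ (hIT j)),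
    integral_finsetSum _ hIZ, integral_finsetSum _ fun j _ => integrable_finsetSum _ (hIT j),
    closedFormDistinct]
  congr 1
  · refine Finset.sum_congr rfl fun i hi => ?_
    rw [integral_const_mul, hterm i _ (hZ i hi).1 (hZ i hi).2]
  · refine Finset.sum_congr rfl fun j _ => ?_
    rw [integral_finsetSum _ (hIT j)]
    refine Finset.sum_congr rfl fun i hi => ?_
    rw [integral_const_mul, hterm i _ (hT j i hi).1 (hT j i hi).2]

theorem basicIntegral_eq_closedForm {N : ℕ} {l : ℕ} (hl : 0 < l) (k : Fin N → ℕ) {a₁ a₂ : ℝ}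
    {a₃ : Fin N → ℝ} (h₁ : 0 < a₁) (h₂ : 0 < a₂) (h₃ : ∀ n, 0 < k n → 0 < a₃ n)
    (h₃₃ : ∀ n m, n ≠ m → 0 < k n → 0 < k m → a₃ n ≠ a₃ m) :
    basicIntegral l k a₁ a₂ a₃ = closedForm l k a₁ a₂ a₃ := by
  classical
  unfold closedForm
  split_ifs with h
  · obtain ⟨m, hm, hma⟩ := h
    set k' : Fin N → ℕ := fun n => if 0 < k n ∧ a₂ = a₃ n then k n + l else k n with hk'
    have hkpos : ∀ n, 0 < k' n → 0 < k n := by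
      intro n hn
      simp only [hk'] at hn
      split_ifs at hn with h
      · exact h.1
      · exact hn
    have hk'm : k' m = k m + l := by simp [hk', hm, hma]
    have hk'n : ∀ n, n ≠ m → k' n = k n := by
      intro n hn
      have : ¬ (0 < k n ∧ a₂ = a₃ n) := fun h => h₃₃ n m hn h.1 hm (h.2.symm.trans hma)
      simp [hk', this]
    -- Distinctness of the active `a₃ n` makes `m` the only index changed by `k'`, so the factor `(x
    -- + a₂)^l` is absorbed exactly once.
    have hint : basicIntegrand l k a₁ a₂ a₃ = basicIntegrand 0 k' a₁ a₂ a₃ := by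
      funext x
      rw [basicIntegrand, basicIntegrand, pow_zero, one_mul]
      congr 1
      rw [← Finset.mul_prod_erase Finset.univ _ (Finset.mem_univ m),
        ← Finset.mul_prod_erase Finset.univ (fun n => (x + a₃ n) ^ k' n) (Finset.mem_univ m),
        hk'm, hma, pow_add, ← mul_assoc, mul_comm ((x + a₃ m) ^ l)]
      congr 1
      exact Finset.prod_congr rfl fun n hn => by rw [hk'n n (Finset.ne_of_mem_erase hn)]
    have hkey := basicIntegral_eq_closedFormDistinct 0 k' (a₂ := a₂) h₁
      (fun h => absurd h (lt_irrefl 0))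
      (fun n hn => h₃ n (hkpos n hn)) (fun n m hnm hn hm => h₃₃ n m hnm (hkpos n hn) (hkpos m hm))
      (fun h => absurd h (lt_irrefl 0)) (Or.inr ⟨m, by omega⟩)
    rw [← hkey, basicIntegral, hint, basicIntegral]
  · push Not at h
    exact basicIntegral_eq_closedFormDistinct l k h₁ (fun _ => h₂) h₃ h₃₃ (fun _ => h) (Or.inl hl)

/-! ### Finite expansion of `Y` -/

namespace JammingNetwork

variable {N M : ℕ} (net : JammingNetwork N M)

theorem one_lt_mu (hrate : 0 < net.rate) : 1 < net.mu := Real.one_lt_rpow one_lt_two hrate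

theorem nu_eq : net.nu = net.mu⁻¹ - 1 := by
  rw [nu, mu, Real.rpow_neg zero_le_two]

theorem nu_neg (hrate : 0 < net.rate) : net.nu < 0 := by
  rw [nu_eq, sub_neg]
  exact inv_lt_one_of_one_lt₀ (net.one_lt_mu hrate)

theorem kappa_pos (hPs : 0 < net.Ps) (hP : ∀ n, 0 < net.P n) (hrate : 0 < net.rate) (n : Fin N) :
    0 < net.kappa n := by
  have h1 := net.nu_neg hrate
  have h2 : 0 < net.Ps / (net.mu * net.P n) :=
    div_pos hPs (mul_pos (one_pos.trans (net.one_lt_mu hrate)) (hP n))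
  rw [kappa]
  linarith

theorem lam_pos (hPs : 0 < net.Ps) (hP : ∀ n, 0 < net.P n) (n : Fin N) : 0 < net.lam n :=
  div_pos hPs (hP n)

theorem lam_injective (hPs : 0 < net.Ps) (hPinj : Function.Injective net.P) :
    Function.Injective net.lam := fun n m h => hPinj (by
  simpa [lam, div_eq_mul_inv, hPs.ne'] using h)

theorem xi_pos (hPs : 0 < net.Ps) (hσD : 0 < net.sigmaD) (hrate : 0 < net.rate) : 0 < net.xi :=
  div_pos (mul_pos (pow_pos hσD 2) (one_pos.trans (net.one_lt_mu hrate))) hPs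

theorem psi_pos (hPs : 0 < net.Ps) (hσD : 0 < net.sigmaD) (hrate : 0 < net.rate)
    (S : Finset (Fin M)) : 0 < net.psi S :=
  add_pos_of_pos_of_nonneg (net.xi_pos hPs hσD hrate)
    (div_nonneg (Finset.sum_nonneg fun _ _ => sq_nonneg _) hPs.le)

theorem expansionY_congr {I J : ℕ → (Fin N → ℕ) → ℝ → ℝ → (Fin N → ℝ) → ℝ}
    (h0 : ∀ l n, l = 1 ∨ l = 2 → I l 0 net.xi (net.kappa n) 0 = J l 0 net.xi (net.kappa n) 0)
    (h : ∀ l k S n, l = 1 ∨ l = 2 → I l k (net.psi S) (net.kappa n) net.lam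
      = J l k (net.psi S) (net.kappa n) net.lam) :
    net.expansionY I = net.expansionY J := by
  simp only [expansionY, h0 1 _ (Or.inl rfl), h0 2 _ (Or.inr rfl), h 1 _ _ _ (Or.inl rfl),
    h 2 _ _ _ (Or.inr rfl)]

theorem multinomial_expansion {x : ℝ} (i : ℕ) :
    (∑ n, net.A n / (x + net.lam n)) ^ i
      = ∑ k ∈ (Finset.univ : Finset (Fin N)).piAntidiag i,
        (i.factorial : ℝ) / (∏ n, ((k n).factorial : ℝ)) * (∏ t, net.A t ^ k t)
          * (∏ n, (x + net.lam n) ^ k n)⁻¹ := by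
  rw [Finset.sum_pow_eq_sum_piAntidiag]
  refine Finset.sum_congr rfl fun k hk => ?_
  have hsum : ∑ n, k n = i := (Finset.mem_piAntidiag.1 hk).1
  have hspec : (∏ n, ((k n).factorial : ℝ)) * (Nat.multinomial Finset.univ k : ℝ)
      = (i.factorial : ℝ) := by
    rw [← hsum]
    exact_mod_cast Nat.multinomial_spec Finset.univ k
  have hne : (∏ n, ((k n).factorial : ℝ)) ≠ 0 :=
    Finset.prod_ne_zero_iff.2 fun n _ => Nat.cast_ne_zero.2 (Nat.factorial_ne_zero _)
  rw [← hspec, mul_div_cancel_left₀ _ hne, mul_assoc]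
  congr 1
  rw [← div_eq_mul_inv, ← Finset.prod_div_distrib]
  exact Finset.prod_congr rfl fun n _ => div_pow _ _ _

/-- Because `expansionY` is linear in its argument, the expansion can be proved for integrands at a
fixed `x` and integrated afterwards. The exponentials of the chosen eavesdroppers combine with
`exp(-ξ x)` into the rate `ψ_S`. -/
theorem integrandY_eq_expansionY (x : ℝ) :
    net.integrandY x = net.expansionY fun l k a₁ a₂ a₃ => basicIntegrand l k a₁ a₂ a₃ x := by
  set T : ℝ := ∑ n, net.A n / (x + net.lam n) with hT
  set B : ℝ := ∑ n, net.A n / net.mu *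
        (net.sigmaD ^ 2 / (x + net.kappa n) + net.Ps / (net.mu * (x + net.kappa n) ^ 2)) with hB
  have hprod : ∏ i, (1 - net.Ps * Real.exp (-(net.sigmaE i ^ 2 * x / net.Ps)) * T)
      = 1 + ∑ i ∈ Finset.Icc 1 M, ∑ S ∈ (Finset.univ : Finset (Fin M)).powersetCard i,
        (-net.Ps) ^ i * T ^ i * Real.exp (-((∑ j ∈ S, net.sigmaE j ^ 2) / net.Ps * x)) := by
    have h1 : ∀ S : Finset (Fin M),
        ∏ i ∈ S, (-(net.Ps * Real.exp (-(net.sigmaE i ^ 2 * x / net.Ps)) * T))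
        = (-net.Ps) ^ S.card * T ^ S.card
          * Real.exp (-((∑ j ∈ S, net.sigmaE j ^ 2) / net.Ps * x)) := by
      intro S
      have h2 : ∀ i, -(net.Ps * Real.exp (-(net.sigmaE i ^ 2 * x / net.Ps)) * T)
          = -net.Ps * T * Real.exp (-(net.sigmaE i ^ 2 * x / net.Ps)) := fun i => by ring
      simp only [h2]
      rw [Finset.prod_mul_distrib, Finset.prod_const, mul_pow, ← Real.exp_sum,
        Finset.sum_neg_distrib, Finset.sum_div, Finset.sum_mul]
      simp only [mul_div_right_comm]
    have h3 : ∏ i, (1 - net.Ps * Real.exp (-(net.sigmaE i ^ 2 * x / net.Ps)) * T)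
        = ∑ S ∈ (Finset.univ : Finset (Fin M)).powerset, (-net.Ps) ^ S.card * T ^ S.card
          * Real.exp (-((∑ j ∈ S, net.sigmaE j ^ 2) / net.Ps * x)) := by
      have h4 : ∀ i, 1 - net.Ps * Real.exp (-(net.sigmaE i ^ 2 * x / net.Ps)) * T
          = -(net.Ps * Real.exp (-(net.sigmaE i ^ 2 * x / net.Ps)) * T) + 1 := fun i => by ring
      simp only [h4]
      rw [Finset.prod_add]
      refine Finset.sum_congr rfl fun S _ => ?_
      rw [h1, Finset.prod_const_one, mul_one]
    -- Subsets are grouped by cardinality; the empty set is split off as the leading 1.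
    rw [h3, Finset.sum_powerset, Finset.card_univ, Fintype.card_fin, Finset.range_eq_Ico,
      Finset.sum_eq_sum_Ico_succ_bot (Nat.succ_pos M)]
    congr 1
    · simp
    · rw [show Finset.Ico (0 + 1) (M + 1) = Finset.Icc 1 M by ext; simp]
      refine Finset.sum_congr rfl fun i _ => Finset.sum_congr rfl fun S hS => ?_
      rw [(Finset.mem_powersetCard.1 hS).2]
  have hterm : ∀ (k : Fin N → ℕ) (a₁ : ℝ) (a₃ : Fin N → ℝ),
      ∑ n, net.A n / net.mu *
          (net.sigmaD ^ 2 * basicIntegrand 1 k a₁ (net.kappa n) a₃ x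
            + net.Ps / net.mu * basicIntegrand 2 k a₁ (net.kappa n) a₃ x)
        = Real.exp (-a₁ * x) * (∏ n, (x + a₃ n) ^ k n)⁻¹ * B := by
    intro k a₁ a₃
    rw [hB, Finset.mul_sum]
    refine Finset.sum_congr rfl fun n _ => ?_
    rw [basicIntegrand, basicIntegrand, pow_one]
    simp only [div_eq_mul_inv, mul_inv]
    ring
  rw [integrandY, expansionY, ← hT, ← hB, hprod]
  clear_value B T
  simp only [hterm]
  rw [add_mul, add_mul, one_mul, Finset.sum_mul, Finset.sum_mul]
  congr 1
  · simp
  · refine Finset.sum_congr rfl fun i _ => ?_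
    rw [Finset.sum_mul, Finset.sum_mul]
    refine Finset.sum_congr rfl fun S _ => ?_
    rw [hT, multinomial_expansion, Finset.mul_sum, Finset.sum_mul, Finset.sum_mul, Finset.sum_mul,
      Finset.mul_sum]
    refine Finset.sum_congr rfl fun k _ => ?_
    have hexp : Real.exp (-net.psi S * x)
        = Real.exp (-((∑ j ∈ S, net.sigmaE j ^ 2) / net.Ps * x)) * Real.exp (-net.xi * x) := by
      rw [← Real.exp_add, psi]
      congr 1
      ring
    rw [hexp]
    ring

/-- `f` is integrable on `(0, ∞)` with integral `c`. -/
def HasIntegralIoi (f : ℝ → ℝ) (c : ℝ) : Prop :=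
  IntegrableOn f (Set.Ioi 0) ∧ ∫ x in Set.Ioi (0 : ℝ), f x = c

theorem HasIntegralIoi.add {f g : ℝ → ℝ} {c d : ℝ} (hf : HasIntegralIoi f c)
    (hg : HasIntegralIoi g d) : HasIntegralIoi (fun x => f x + g x) (c + d) :=
  ⟨hf.1.add hg.1, by rw [integral_add hf.1 hg.1, hf.2, hg.2]⟩

theorem HasIntegralIoi.const_mul {f : ℝ → ℝ} {c : ℝ} (r : ℝ) (hf : HasIntegralIoi f c) :
    HasIntegralIoi (fun x => r * f x) (r * c) :=
  ⟨hf.1.const_mul r, by rw [integral_const_mul, hf.2]⟩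

theorem HasIntegralIoi.sum {ι : Type*} (s : Finset ι) {f : ι → ℝ → ℝ} {c : ι → ℝ}
    (hf : ∀ i, HasIntegralIoi (f i) (c i)) :
    HasIntegralIoi (fun x => ∑ i ∈ s, f i x) (∑ i ∈ s, c i) :=
  ⟨integrable_finsetSum s fun i _ => (hf i).1, by
    rw [integral_finsetSum s fun i _ => (hf i).1]
    exact Finset.sum_congr rfl fun i _ => (hf i).2⟩

theorem hasIntegralIoi_integrandY (hPs : 0 < net.Ps) (hP : ∀ n, 0 < net.P n)
    (hσD : 0 < net.sigmaD) (hrate : 0 < net.rate) :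
    HasIntegralIoi net.integrandY (net.expansionY basicIntegral) := by
  rw [show net.integrandY = _ from funext net.integrandY_eq_expansionY]
  have h0 : ∀ l (n : Fin N), HasIntegralIoi (basicIntegrand (N := N) l 0 net.xi (net.kappa n) 0)
      (basicIntegral (N := N) l 0 net.xi (net.kappa n) 0) := fun l n =>
    ⟨integrableOn_basicIntegrand l 0 (net.xi_pos hPs hσD hrate)
      (fun _ => net.kappa_pos hPs hP hrate n) (fun n hn => absurd hn (lt_irrefl 0)), rfl⟩
  have h1 : ∀ l k S (n : Fin N), HasIntegralIoi (basicIntegrand l k (net.psi S) (net.kappa n) net.lam)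
      (basicIntegral l k (net.psi S) (net.kappa n) net.lam) := fun l k S n =>
    ⟨integrableOn_basicIntegrand l k (net.psi_pos hPs hσD hrate S)
      (fun _ => net.kappa_pos hPs hP hrate n) (fun n _ => net.lam_pos hPs hP n), rfl⟩
  unfold expansionY
  exact (HasIntegralIoi.sum _ fun n => (((h0 1 n).const_mul _).add
    ((h0 2 n).const_mul _)).const_mul _).add
    (HasIntegralIoi.sum _ fun i => HasIntegralIoi.sum _ fun S =>
      (HasIntegralIoi.sum _ fun k => (HasIntegralIoi.sum _ fun n =>
        (((h1 1 k S n).const_mul _).add ((h1 2 k S n).const_mul _)).const_mul _).const_mul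
          _).const_mul _)

theorem expansionY_basicIntegral_eq_closedForm (hPs : 0 < net.Ps) (hP : ∀ n, 0 < net.P n)
    (hPinj : Function.Injective net.P) (hσD : 0 < net.sigmaD) (hrate : 0 < net.rate) :
    net.expansionY basicIntegral = net.expansionY closedForm := by
  refine net.expansionY_congr (fun l n hl => ?_) fun l k S n hl => ?_
  -- With `k = 0` there are no active `a₃` poles, so the dummy value `a₃ = 0` is harmless.
  · exact basicIntegral_eq_closedForm (by omega) 0 (net.xi_pos hPs hσD hrate)
      (net.kappa_pos hPs hP hrate n) (fun n hn => absurd hn (lt_irrefl 0))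
      (fun n m _ hn => absurd hn (lt_irrefl 0))
  · exact basicIntegral_eq_closedForm (by omega) k (net.psi_pos hPs hσD hrate S)
      (net.kappa_pos hPs hP hrate n) (fun n _ => net.lam_pos hPs hP n)
      (fun n m hnm _ _ h => hnm (net.lam_injective hPs hPinj h))

theorem expansionY_closedForm_eq_closedFormDistinct (h : ∀ n m, net.kappa n ≠ net.lam m) :
    net.expansionY closedForm = net.expansionY closedFormDistinct := by
  refine net.expansionY_congr (fun l n _ => if_neg ?_) fun l k S n _ => if_neg ?_
  · rintro ⟨m, hm, _⟩
    exact lt_irrefl 0 hm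
  · rintro ⟨m, _, hm⟩
    exact h n m hm

end JammingNetwork

/-! ### The standard complex Gaussian law -/

theorem stdComplexGaussian_eq_withDensity :
    stdComplexGaussian = (volume : Measure ℂ).withDensity
      (fun z => ENNReal.ofReal (Real.pi⁻¹ * Real.exp (-‖z‖ ^ 2))) := by
  have hv : (1 / 2 : ℝ≥0) ≠ 0 := by norm_num
  have hpdf : ∀ x : ℝ, gaussianPDF 0 (1 / 2) x
      = ENNReal.ofReal ((√Real.pi)⁻¹ * Real.exp (-x ^ 2)) := by
    intro x
    rw [gaussianPDF, gaussianPDFReal]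
    congr 2
    · rw [show 2 * Real.pi * ((1 / 2 : ℝ≥0) : ℝ) = Real.pi by push_cast; ring]
    · congr 1
      simp
  rw [stdComplexGaussian, gaussianReal_of_var_ne_zero _ hv,
    prod_withDensity (measurable_gaussianPDF _ _) (measurable_gaussianPDF _ _)]
  have hmap : (fun p : ℝ × ℝ => (⟨p.1, p.2⟩ : ℂ)) = Complex.measurableEquivRealProd.symm := rfl
  rw [hmap]
  ext s hs
  have hmp := Complex.volume_preserving_equiv_real_prod.symm
  rw [Measure.map_apply (MeasurableEquiv.measurable _) hs, withDensity_apply _ hs,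
    withDensity_apply _ (MeasurableEquiv.measurable _ hs),
    ← hmp.setLIntegral_comp_preimage_emb (MeasurableEquiv.measurableEmbedding _)]
  refine lintegral_congr fun p => ?_
  rw [hpdf, hpdf, ← ENNReal.ofReal_mul (by positivity), Complex.sq_norm, Complex.normSq_apply]
  congr 1
  change _ = Real.pi⁻¹ * Real.exp (-(p.1 * p.1 + p.2 * p.2))
  have : (√Real.pi)⁻¹ * (√Real.pi)⁻¹ = Real.pi⁻¹ := by
    rw [← mul_inv, Real.mul_self_sqrt Real.pi_pos.le]
  rw [mul_mul_mul_comm, this, ← Real.exp_add]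
  ring_nf

instance : IsProbabilityMeasure stdComplexGaussian :=
  Measure.isProbabilityMeasure_map (by
    have hmap : (fun p : ℝ × ℝ => (⟨p.1, p.2⟩ : ℂ)) = Complex.measurableEquivRealProd.symm := rfl
    rw [hmap]
    exact (MeasurableEquiv.measurable _).aemeasurable)

/-- In polar coordinates the density is radial, and `2 r exp(-r²)` has the antiderivative
`-exp(-r²)`. Thus `|h|²` is exponential with mean 1. -/
theorem stdComplexGaussian_le_sq_norm {t : ℝ} (ht : 0 ≤ t) :
    stdComplexGaussian {z | t ≤ ‖z‖ ^ 2} = ENNReal.ofReal (Real.exp (-t)) := by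
  have hs : MeasurableSet {z : ℂ | t ≤ ‖z‖ ^ 2} :=
    measurableSet_le measurable_const (by fun_prop)
  rw [stdComplexGaussian_eq_withDensity, withDensity_apply _ hs, ← lintegral_indicator hs,
    ← Complex.lintegral_comp_polarCoord_symm]
  have hint : ∫ r in Set.Ioi (√t), 2 * r * Real.exp (-r ^ 2) = Real.exp (-t) ∧
      IntegrableOn (fun r => 2 * r * Real.exp (-r ^ 2)) (Set.Ioi (√t)) := by
    have hd : ∀ r : ℝ, HasDerivAt (fun r : ℝ => -Real.exp (-r ^ 2))
        (2 * r * Real.exp (-r ^ 2)) r := by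
      intro r
      refine (((hasDerivAt_pow 2 r).neg).exp.neg).congr_deriv ?_
      simp only [Pi.neg_apply]
      push_cast
      ring
    have hlim : Filter.Tendsto (fun r : ℝ => -Real.exp (-r ^ 2)) Filter.atTop (nhds 0) := by
      have := (Real.tendsto_exp_atBot.comp (Filter.tendsto_neg_atTop_atBot.comp
        (Filter.tendsto_pow_atTop (α := ℝ) two_ne_zero))).neg
      simpa [Function.comp_def] using this
    have hpos : ∀ r ∈ Set.Ioi (√t), 0 ≤ 2 * r * Real.exp (-r ^ 2) := fun r hr => by
      have : 0 < r := (Real.sqrt_nonneg t).trans_lt hr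
      positivity
    refine ⟨?_, integrableOn_Ioi_deriv_of_nonneg (hd _).continuousAt.continuousWithinAt
      (fun r _ => hd r) hpos hlim⟩
    rw [integral_Ioi_of_hasDerivAt_of_nonneg (hd _).continuousAt.continuousWithinAt
      (fun r _ => hd r) hpos hlim, Real.sq_sqrt ht]
    ring
  have hval : ∀ p ∈ polarCoord.target, ENNReal.ofReal p.1 • Set.indicator {z : ℂ | t ≤ ‖z‖ ^ 2}
        (fun z => ENNReal.ofReal (Real.pi⁻¹ * Real.exp (-‖z‖ ^ 2))) (Complex.polarCoord.symm p)
      = Set.indicator (Set.Ici (√t)) (fun r => ENNReal.ofReal ((2 * Real.pi)⁻¹ *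
          (2 * r * Real.exp (-r ^ 2)))) p.1 * 1 := by
    intro p hp
    have hp1 : 0 < p.1 := by
      rw [polarCoord_target] at hp
      exact hp.1
    have hnorm : ‖Complex.polarCoord.symm p‖ = p.1 := by
      rw [Complex.norm_polarCoord_symm, abs_of_pos hp1]
    rw [mul_one, smul_eq_mul]
    by_cases h : √t ≤ p.1
    · have h' : t ≤ p.1 ^ 2 := (Real.sqrt_le_left hp1.le).1 h
      rw [Set.indicator_of_mem (by simpa [hnorm] using h'), Set.indicator_of_mem (by simpa using h),
        hnorm, ← ENNReal.ofReal_mul hp1.le]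
      congr 1
      have := Real.pi_ne_zero
      field_simp
    · have h' : ¬ t ≤ p.1 ^ 2 := fun h' => h ((Real.sqrt_le_left hp1.le).2 h')
      rw [Set.indicator_of_notMem (by simpa [hnorm] using h'),
        Set.indicator_of_notMem (by simpa using h), mul_zero]
  rw [setLIntegral_congr_fun (polarCoord.open_target.measurableSet) hval, polarCoord_target,
    Measure.volume_eq_prod, ← Measure.prod_restrict,
    lintegral_prod_mul (f := Set.indicator (Set.Ici (√t)) fun r => ENNReal.ofReal
      ((2 * Real.pi)⁻¹ * (2 * r * Real.exp (-r ^ 2)))) (g := fun _ => 1)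
      ((Measurable.indicator (by fun_prop) measurableSet_Ici).aemeasurable) (by fun_prop),
    lintegral_one, Measure.restrict_apply_univ, Real.volume_Ioo,
    lintegral_indicator measurableSet_Ici, Measure.restrict_restrict measurableSet_Ici]
  have hset : (Set.Ici (√t) ∩ Set.Ioi 0 : Set ℝ) =ᵐ[volume] Set.Ioi (√t) := by
    have h1 : (Set.Ici (√t) ∩ Set.Ioi 0 : Set ℝ) =ᵐ[volume] (Set.Ioi (√t) ∩ Set.Ioi 0 : Set ℝ) :=
      Ioi_ae_eq_Ici.symm.inter (Filter.EventuallyEq.refl _ _)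
    rwa [Set.inter_eq_left.2 (Set.Ioi_subset_Ioi (Real.sqrt_nonneg t))] at h1
  rw [setLIntegral_congr hset, ← ofReal_integral_eq_lintegral_ofReal (hint.2.const_mul _)
    ((ae_restrict_iff' measurableSet_Ioi).2 (Filter.Eventually.of_forall fun r hr => by
      have : 0 < r := (Real.sqrt_nonneg t).trans_lt hr
      have := Real.pi_pos
      simp only [Pi.zero_apply]
      positivity)), integral_const_mul, hint.1, ← ENNReal.ofReal_mul (by positivity)]
  congr 1
  have := Real.pi_ne_zero
  field_simp
  ring

theorem integral_exp_neg_mul_sq_norm_stdComplexGaussian {s : ℝ} (hs : 0 ≤ s) :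
    ∫ z, Real.exp (-(s * ‖z‖ ^ 2)) ∂stdComplexGaussian = (1 + s)⁻¹ := by
  rw [stdComplexGaussian_eq_withDensity,
    integral_withDensity_eq_integral_toReal_smul (by fun_prop) (by simp)]
  have h : ∀ z : ℂ, (ENNReal.ofReal (Real.pi⁻¹ * Real.exp (-‖z‖ ^ 2))).toReal •
      Real.exp (-(s * ‖z‖ ^ 2)) = Real.pi⁻¹ * Real.exp (-(1 + s) * ‖z‖ ^ 2) := by
    intro z
    rw [ENNReal.toReal_ofReal (by positivity), smul_eq_mul, mul_assoc, ← Real.exp_add]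
    ring_nf
  simp only [h]
  rw [integral_const_mul, GaussianFourier.integral_rexp_neg_mul_sq_norm (by positivity),
    Complex.finrank_real_complex]
  have := Real.pi_ne_zero
  norm_num
  field_simp

/-! ### SINR distribution at a single receiver -/

/-- The law of the channel coefficients seen by one receiver. -/
def receiverLaw (N : ℕ) : Measure (ℂ × (Fin N → ℂ)) :=
  stdComplexGaussian.prod (Measure.pi fun _ => stdComplexGaussian)

instance (N : ℕ) : IsProbabilityMeasure (receiverLaw N) := by
  unfold receiverLaw
  infer_instance

namespace JammingNetwork

variable {N M : ℕ} (net : JammingNetwork N M)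

theorem measurable_sinr (σ : ℝ) :
    Measurable fun v : ℂ × (Fin N → ℂ) => net.sinr σ v.1 v.2 := by
  unfold sinr
  fun_prop

theorem sinr_nonneg (hPs : 0 < net.Ps) (hP : ∀ n, 0 < net.P n) (σ : ℝ) (h : ℂ) (g : Fin N → ℂ) :
    0 ≤ net.sinr σ h g :=
  div_nonneg (mul_nonneg hPs.le (sq_nonneg _)) (add_nonneg
    (Finset.sum_nonneg fun n _ => mul_nonneg (hP n).le (sq_nonneg _)) (sq_nonneg _))

/-- For fixed jammer gains the event is a lower bound on `|h|²`, of probability the exponential of a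
sum over jammers. Its average over independent gains is a product of Laplace transforms `(1 + s)⁻¹`
of `|g|²`. -/
theorem receiverLaw_le_sinr (hPs : 0 < net.Ps) (hP : ∀ n, 0 < net.P n) {σ : ℝ} (hσ : 0 < σ)
    {t : ℝ} (ht : 0 ≤ t) :
    receiverLaw N {v | t ≤ net.sinr σ v.1 v.2}
      = ENNReal.ofReal (Real.exp (-(σ ^ 2 * t / net.Ps)) * ∏ n, (1 + t * net.P n / net.Ps)⁻¹) := by
  have hD : ∀ g : Fin N → ℂ, 0 < ∑ n, net.P n * ‖g n‖ ^ 2 + σ ^ 2 := fun g =>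
    add_pos_of_nonneg_of_pos (Finset.sum_nonneg fun n _ => mul_nonneg (hP n).le (sq_nonneg _))
      (pow_pos hσ 2)
  have hset : ∀ g : Fin N → ℂ, (fun h : ℂ => (h, g)) ⁻¹' {v | t ≤ net.sinr σ v.1 v.2}
      = {h | t * (∑ n, net.P n * ‖g n‖ ^ 2 + σ ^ 2) / net.Ps ≤ ‖h‖ ^ 2} := by
    intro g
    ext h
    simp only [Set.mem_preimage, Set.mem_ofPred_eq, sinr]
    rw [le_div_iff₀ (hD g), div_le_iff₀ hPs, mul_comm net.Ps]
  have hexp : ∀ g : Fin N → ℂ, Real.exp (-(t * (∑ n, net.P n * ‖g n‖ ^ 2 + σ ^ 2) / net.Ps))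
      = Real.exp (-(σ ^ 2 * t / net.Ps)) *
        ∏ n, Real.exp (-(t * net.P n / net.Ps * ‖g n‖ ^ 2)) := by
    intro g
    rw [← Real.exp_sum, ← Real.exp_add, Finset.sum_neg_distrib, ← neg_add, add_comm,
      mul_add, add_div, Finset.mul_sum, Finset.sum_div]
    congr 3
    · ring
    · exact Finset.sum_congr rfl fun n _ => by ring
  rw [receiverLaw, Measure.prod_apply_symm (measurableSet_le measurable_const
    (net.measurable_sinr σ))]
  have hpt : ∀ g : Fin N → ℂ,
      stdComplexGaussian ((fun h : ℂ => (h, g)) ⁻¹' {v | t ≤ net.sinr σ v.1 v.2})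
      = ENNReal.ofReal (Real.exp (-(σ ^ 2 * t / net.Ps)) *
        ∏ n, Real.exp (-(t * net.P n / net.Ps * ‖g n‖ ^ 2))) := by
    intro g
    rw [hset, stdComplexGaussian_le_sq_norm (div_nonneg (mul_nonneg ht (hD g).le) hPs.le), hexp]
  simp only [hpt]
  rw [← ofReal_integral_eq_lintegral_ofReal, integral_const_mul,
    integral_fintype_prod_eq_prod (fun n (z : ℂ) => Real.exp (-(t * net.P n / net.Ps * ‖z‖ ^ 2)))]
  · congr 2
    exact Finset.prod_congr rfl fun n _ => integral_exp_neg_mul_sq_norm_stdComplexGaussian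
      (div_nonneg (mul_nonneg ht (hP n).le) hPs.le)
  · refine Integrable.of_bound (C := 1) (Measurable.aestronglyMeasurable (by fun_prop))
      (Filter.Eventually.of_forall fun g => ?_)
    rw [← hexp, Real.norm_of_nonneg (Real.exp_pos _).le, Real.exp_le_one_iff, neg_nonpos]
    exact div_nonneg (mul_nonneg ht (hD g).le) hPs.le
  · exact Filter.Eventually.of_forall fun g => by
      simp only [Pi.zero_apply]
      positivity

/-- Partial fractions with simple poles at `-λ_n`; the residues, rescaled by the `λ_k`, are the
`A_n`. -/
theorem prod_eq_sum_A (hN : 0 < N) (hPs : 0 < net.Ps) (hP : ∀ n, 0 < net.P n)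
    (hPinj : Function.Injective net.P) {t : ℝ} (ht : 0 ≤ t) :
    ∏ n, (1 + t * net.P n / net.Ps)⁻¹ = net.Ps * ∑ n, net.A n / (t + net.lam n) := by
  have hl := net.lam_pos hPs hP
  have hpf := partialFraction (fun _ : Fin N => 1) net.lam ⟨⟨0, hN⟩, one_pos⟩
    (fun i j hij _ _ h => hij (net.lam_injective hPs hPinj h)) t
    (fun i _ => (add_pos_of_nonneg_of_pos ht (hl i)).ne')
  simp only [pow_one, Finset.Icc_self, Finset.sum_singleton, Nat.sub_self, Nat.factorial_zero,
    Nat.cast_one, div_one, one_mul, iteratedDeriv_zero] at hpf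
  have h1 : ∀ n, (1 + t * net.P n / net.Ps)⁻¹ = net.lam n * (t + net.lam n)⁻¹ := by
    intro n
    have h2 := (add_pos_of_nonneg_of_pos ht (hl n)).ne'
    have h3 := (hP n).ne'
    have h4 : 1 + t * net.P n / net.Ps = (t + net.lam n) / net.lam n := by
      rw [lam]
      field_simp
      ring
    rw [h4, inv_div, div_eq_mul_inv]
  simp only [h1]
  rw [Finset.prod_mul_distrib, hpf, Finset.mul_sum, Finset.mul_sum]
  refine Finset.sum_congr rfl fun n _ => ?_
  rw [← mul_assoc, div_eq_mul_inv, ← mul_assoc]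
  congr 1
  rw [← Finset.mul_prod_erase Finset.univ _ (Finset.mem_univ n), mul_assoc,
    ← Finset.prod_mul_distrib, A, mul_inv, ← Finset.prod_inv_distrib, ← mul_assoc]
  congr 1
  refine Finset.prod_congr rfl fun k hk => ?_
  rw [lam, lam]
  have h1 := (hP k).ne'
  have h2 := (hP n).ne'
  have h3 := hPs.ne'
  have h4 : net.P n - net.P k ≠ 0 :=
    sub_ne_zero.2 fun h => Finset.ne_of_mem_erase hk (hPinj h).symm
  have h5 : -(net.Ps / net.P n) + net.Ps / net.P k
      = net.Ps * (net.P n - net.P k) / (net.P n * net.P k) := by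
    field_simp
    ring
  have h6 : 1 - net.P k / net.P n = (net.P n - net.P k) / net.P n := by
    field_simp
  rw [h5, h6]
  field_simp

end JammingNetwork

/-! ### Single-integral form of the no-outage probability -/

namespace JammingNetwork

variable {N M : ℕ} (net : JammingNetwork N M)

/-- The density at `x` of `γ_D / μ + ν`. -/
def densityD (x : ℝ) : ℝ :=
  net.mu * Real.exp (net.xi * net.nu) * (Real.exp (-net.xi * x) * ∑ n, net.A n / net.mu *
    (net.sigmaD ^ 2 / (x + net.kappa n) + net.Ps / (net.mu * (x + net.kappa n) ^ 2)))

/-- The probability that `γ_D / μ + ν` is at least `x`. -/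
def survivalD (x : ℝ) : ℝ :=
  Real.exp (-(net.sigmaD ^ 2 * (net.mu * (x - net.nu)) / net.Ps)) *
    ∏ n, (1 + net.mu * (x - net.nu) * net.P n / net.Ps)⁻¹

theorem survivalD_eq (hN : 0 < N) (hPs : 0 < net.Ps) (hP : ∀ n, 0 < net.P n)
    (hPinj : Function.Injective net.P) (hrate : 0 < net.rate) {x : ℝ} (hx : 0 ≤ x) :
    net.survivalD x = Real.exp (net.xi * net.nu) * net.Ps *
      (Real.exp (-net.xi * x) * ∑ n, net.A n / net.mu * (x + net.kappa n)⁻¹) := by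
  have hmu := one_pos.trans (net.one_lt_mu hrate)
  have hnu := net.nu_neg hrate
  have hexp : Real.exp (-(net.sigmaD ^ 2 * (net.mu * (x - net.nu)) / net.Ps))
      = Real.exp (net.xi * net.nu) * Real.exp (-net.xi * x) := by
    rw [← Real.exp_add, xi]
    congr 1
    ring
  rw [survivalD, net.prod_eq_sum_A hN hPs hP hPinj (mul_nonneg hmu.le (by linarith)), hexp]
  have : ∀ n, net.A n / (net.mu * (x - net.nu) + net.lam n)
      = net.A n / net.mu * (x + net.kappa n)⁻¹ := by
    intro n
    have h1 := (hP n).ne'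
    -- This is the origin of `κ_n`: it equals `λ_n / μ - ν`.
    have h2 : net.mu * (x - net.nu) + net.lam n = net.mu * (x + net.kappa n) := by
      rw [lam, kappa]
      field_simp
      ring
    rw [h2, div_mul_eq_div_div, div_eq_mul_inv _ (x + _)]
  simp only [this]
  ring

theorem hasDerivAt_survivalD (hN : 0 < N) (hPs : 0 < net.Ps) (hP : ∀ n, 0 < net.P n)
    (hPinj : Function.Injective net.P) (hrate : 0 < net.rate) {x : ℝ} (hx : 0 < x) :
    HasDerivAt net.survivalD (-net.densityD x) x := by
  have hmu := one_pos.trans (net.one_lt_mu hrate)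
  have heq : net.survivalD =ᶠ[nhds x] fun x => Real.exp (net.xi * net.nu) * net.Ps *
      (Real.exp (-net.xi * x) * ∑ n, net.A n / net.mu * (x + net.kappa n)⁻¹) := by
    filter_upwards [lt_mem_nhds hx] with y hy
    exact net.survivalD_eq hN hPs hP hPinj hrate hy.le
  refine HasDerivAt.congr_of_eventuallyEq ?_ heq
  have h1 : HasDerivAt (fun x : ℝ => Real.exp (-net.xi * x))
      (Real.exp (-net.xi * x) * (-net.xi)) x := by
    simpa using ((hasDerivAt_id x).const_mul (-net.xi)).exp
  have h2 : HasDerivAt (fun x : ℝ => ∑ n, net.A n / net.mu * (x + net.kappa n)⁻¹)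
      (∑ n, net.A n / net.mu * (-1 / (x + net.kappa n) ^ 2)) x := by
    refine HasDerivAt.fun_sum fun n _ => HasDerivAt.const_mul _ ?_
    exact ((hasDerivAt_id x).add_const _).inv
      (add_pos hx (net.kappa_pos hPs hP hrate n)).ne'
  refine ((h1.mul h2).const_mul _).congr_deriv ?_
  rw [densityD, mul_assoc (Real.exp (-net.xi * x)), ← mul_add, Finset.mul_sum,
    ← Finset.sum_add_distrib, Finset.mul_sum, Finset.mul_sum, Finset.mul_sum, Finset.mul_sum,
    ← Finset.sum_neg_distrib]
  refine Finset.sum_congr rfl fun n _ => ?_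
  have := (add_pos hx (net.kappa_pos hPs hP hrate n)).ne'
  rw [show net.xi = net.sigmaD ^ 2 * net.mu / net.Ps from rfl]
  field_simp
  ring

theorem antitoneOn_survivalD (hPs : 0 < net.Ps) (hP : ∀ n, 0 < net.P n) (hrate : 0 < net.rate) :
    AntitoneOn net.survivalD (Set.Ioi 0) := by
  have hmu := one_pos.trans (net.one_lt_mu hrate)
  have hnu := net.nu_neg hrate
  intro x hx y hy hxy
  have hx : 0 < x := hx
  have hpos : ∀ n, 0 < 1 + net.mu * (x - net.nu) * net.P n / net.Ps := fun n =>
    add_pos_of_pos_of_nonneg one_pos (div_nonneg (mul_nonneg (mul_nonneg hmu.le (by linarith))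
      (hP n).le) hPs.le)
  have hle : ∀ n, 1 + net.mu * (x - net.nu) * net.P n / net.Ps
      ≤ 1 + net.mu * (y - net.nu) * net.P n / net.Ps := fun n => by
    have := (hP n).le
    gcongr
  unfold survivalD
  refine mul_le_mul ?_ ?_ (Finset.prod_nonneg fun n _ => inv_nonneg.2 ((hpos n).le.trans (hle n)))
    (Real.exp_pos _).le
  · gcongr
  · exact Finset.prod_le_prod (fun n _ => inv_nonneg.2 ((hpos n).le.trans (hle n)))
      fun n _ => inv_anti₀ (hpos n) (hle n)

/-- The `A_n` can have either sign, so positivity is not visible in the formula; it comes from the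
monotonicity of the tail, which is clear in product form. -/
theorem densityD_nonneg (hN : 0 < N) (hPs : 0 < net.Ps) (hP : ∀ n, 0 < net.P n)
    (hPinj : Function.Injective net.P) (hrate : 0 < net.rate) {x : ℝ} (hx : 0 < x) :
    0 ≤ net.densityD x := by
  have h1 := (net.antitoneOn_survivalD hPs hP hrate).derivWithin_nonpos (x := x)
  rw [(net.hasDerivAt_survivalD hN hPs hP hPinj hrate hx).hasDerivWithinAt.derivWithin
    (isOpen_Ioi.uniqueDiffWithinAt hx)] at h1
  linarith

theorem continuousAt_survivalD (hPs : 0 < net.Ps) (hP : ∀ n, 0 < net.P n) (hrate : 0 < net.rate)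
    {x : ℝ} (hx : 0 ≤ x) : ContinuousAt net.survivalD x := by
  have hmu := one_pos.trans (net.one_lt_mu hrate)
  have hnu := net.nu_neg hrate
  unfold survivalD
  refine ContinuousAt.mul (by fun_prop) (tendsto_finsetProd _ fun n _ => ?_)
  refine ContinuousAt.inv₀ (by fun_prop) (ne_of_gt ?_)
  exact add_pos_of_pos_of_nonneg one_pos (div_nonneg (mul_nonneg (mul_nonneg hmu.le
    (by linarith)) (hP n).le) hPs.le)

theorem tendsto_survivalD (hN : 0 < N) (hPs : 0 < net.Ps) (hP : ∀ n, 0 < net.P n)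
    (hPinj : Function.Injective net.P) (hσD : 0 < net.sigmaD) (hrate : 0 < net.rate) :
    Filter.Tendsto net.survivalD Filter.atTop (nhds 0) := by
  have hxi := net.xi_pos hPs hσD hrate
  have h1 : Filter.Tendsto (fun x : ℝ => Real.exp (-net.xi * x)) Filter.atTop (nhds 0) :=
    Real.tendsto_exp_atBot.comp (Filter.tendsto_id.const_mul_atTop_of_neg (neg_lt_zero.2 hxi))
  have h2 : Filter.Tendsto (fun x : ℝ => ∑ n, net.A n / net.mu * (x + net.kappa n)⁻¹)
      Filter.atTop (nhds (∑ n, net.A n / net.mu * 0)) :=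
    tendsto_finsetSum _ fun n _ => Filter.Tendsto.const_mul _
      (Filter.tendsto_atTop_add_const_right _ _ Filter.tendsto_id).inv_tendsto_atTop
  have h3 := (h1.mul h2).const_mul (Real.exp (net.xi * net.nu) * net.Ps)
  rw [zero_mul, mul_zero] at h3
  refine h3.congr' ?_
  filter_upwards [Filter.eventually_ge_atTop 0] with x hx
  exact (net.survivalD_eq hN hPs hP hPinj hrate hx).symm

theorem lintegral_densityD (hN : 0 < N) (hPs : 0 < net.Ps) (hP : ∀ n, 0 < net.P n)
    (hPinj : Function.Injective net.P) (hσD : 0 < net.sigmaD) (hrate : 0 < net.rate) {y : ℝ}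
    (hy : 0 ≤ y) :
    ∫⁻ x in Set.Ioi y, ENNReal.ofReal (net.densityD x) = ENNReal.ofReal (net.survivalD y) := by
  have hc := (net.continuousAt_survivalD hPs hP hrate hy).continuousWithinAt (s := Set.Ici y)
  have hd : ∀ x ∈ Set.Ioi y, HasDerivAt net.survivalD (-net.densityD x) x := fun x hx =>
    net.hasDerivAt_survivalD hN hPs hP hPinj hrate (hy.trans_lt hx)
  have hn : ∀ x ∈ Set.Ioi y, 0 ≤ net.densityD x := fun x hx =>
    net.densityD_nonneg hN hPs hP hPinj hrate (hy.trans_lt hx)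
  have hlim := net.tendsto_survivalD hN hPs hP hPinj hσD hrate
  have hI := integrableOn_Ioi_deriv_of_nonpos hc hd (fun x hx => neg_nonpos.2 (hn x hx)) hlim
  have hv := integral_Ioi_of_hasDerivAt_of_nonpos hc hd (fun x hx => neg_nonpos.2 (hn x hx)) hlim
  have hI' : IntegrableOn net.densityD (Set.Ioi y) := by simpa using hI.neg
  rw [integral_neg, zero_sub, neg_inj] at hv
  rw [← hv, ofReal_integral_eq_lintegral_ofReal hI'
    ((ae_restrict_iff' measurableSet_Ioi).2 (Filter.Eventually.of_forall hn))]

theorem measurable_densityD : Measurable net.densityD := by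
  unfold densityD
  fun_prop

theorem measurable_iSup_sinr :
    Measurable fun w : Fin M → ℂ × (Fin N → ℂ) =>
      ⨆ m, net.sinr (net.sigmaE m) (w m).1 (w m).2 := by
  refine Measurable.iSup fun m => ?_
  exact (net.measurable_sinr (net.sigmaE m)).comp (measurable_pi_apply m)

/-- The nonnegativity clause is what allows `ENNReal.ofReal` to pass through the product over
eavesdroppers. -/
theorem receiverLaw_sinr_lt (hN : 0 < N) (hPs : 0 < net.Ps) (hP : ∀ n, 0 < net.P n)
    (hPinj : Function.Injective net.P) {σ : ℝ} (hσ : 0 < σ) {t : ℝ} (ht : 0 ≤ t) :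
    0 ≤ 1 - net.Ps * Real.exp (-(σ ^ 2 * t / net.Ps)) * ∑ n, net.A n / (t + net.lam n) ∧
    receiverLaw N {v | net.sinr σ v.1 v.2 < t} = ENNReal.ofReal
      (1 - net.Ps * Real.exp (-(σ ^ 2 * t / net.Ps)) * ∑ n, net.A n / (t + net.lam n)) := by
  have h1 := net.receiverLaw_le_sinr hPs hP hσ ht
  rw [net.prod_eq_sum_A hN hPs hP hPinj ht] at h1
  have hnn : 0 ≤ Real.exp (-(σ ^ 2 * t / net.Ps)) *
      (net.Ps * ∑ n, net.A n / (t + net.lam n)) := by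
    rw [← net.prod_eq_sum_A hN hPs hP hPinj ht]
    exact mul_nonneg (Real.exp_pos _).le (Finset.prod_nonneg fun n _ => inv_nonneg.2
      (add_nonneg zero_le_one (div_nonneg (mul_nonneg ht (hP n).le) hPs.le)))
  have hle : Real.exp (-(σ ^ 2 * t / net.Ps)) *
      (net.Ps * ∑ n, net.A n / (t + net.lam n)) ≤ 1 := by
    rw [← ENNReal.ofReal_le_one, ← h1]
    exact prob_le_one
  have hcompl : {v : ℂ × (Fin N → ℂ) | net.sinr σ v.1 v.2 < t}
      = {v | t ≤ net.sinr σ v.1 v.2}ᶜ := by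
    ext v
    simp
  have hre : net.Ps * Real.exp (-(σ ^ 2 * t / net.Ps)) * ∑ n, net.A n / (t + net.lam n)
      = Real.exp (-(σ ^ 2 * t / net.Ps)) * (net.Ps * ∑ n, net.A n / (t + net.lam n)) := by ring
  refine ⟨by rw [hre]; linarith, ?_⟩
  rw [hcompl, prob_compl_eq_one_sub (measurableSet_le measurable_const (net.measurable_sinr σ)), h1,
    hre, ENNReal.ofReal_sub _ hnn, ENNReal.ofReal_one]

theorem pi_receiverLaw_iSup_sinr_lt (hN : 0 < N) (hM : 0 < M) (hPs : 0 < net.Ps)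
    (hP : ∀ n, 0 < net.P n) (hPinj : Function.Injective net.P) (hσE : ∀ m, 0 < net.sigmaE m)
    {t : ℝ} (ht : 0 ≤ t) :
    Measure.pi (fun _ : Fin M => receiverLaw N)
        {w | ⨆ m, net.sinr (net.sigmaE m) (w m).1 (w m).2 < t}
      = ENNReal.ofReal (∏ i, (1 - net.Ps * Real.exp (-(net.sigmaE i ^ 2 * t / net.Ps)) *
          ∑ n, net.A n / (t + net.lam n))) := by
  have hset : {w : Fin M → ℂ × (Fin N → ℂ) |
        ⨆ m, net.sinr (net.sigmaE m) (w m).1 (w m).2 < t}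
      = Set.univ.pi fun m => {v | net.sinr (net.sigmaE m) v.1 v.2 < t} := by
    have : Nonempty (Fin M) := ⟨⟨0, hM⟩⟩
    ext w
    simp only [Set.mem_ofPred_eq, Set.mem_pi, Set.mem_univ, true_implies]
    constructor
    · intro h m
      exact (le_ciSup (f := fun m => net.sinr (net.sigmaE m) (w m).1 (w m).2)
        (Set.finite_range _).bddAbove m).trans_lt h
    · intro h
      obtain ⟨m, hm⟩ := exists_eq_ciSup_of_finite
        (f := fun m => net.sinr (net.sigmaE m) (w m).1 (w m).2)
      rw [← hm]
      exact h m
  rw [hset, Measure.pi_pi, ENNReal.ofReal_prod_of_nonneg fun i _ =>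
    (net.receiverLaw_sinr_lt hN hPs hP hPinj (hσE i) ht).1]
  exact Finset.prod_congr rfl fun i _ => (net.receiverLaw_sinr_lt hN hPs hP hPinj (hσE i) ht).2

/-- Condition on the eavesdroppers, write the tail of `γ_D / μ + ν` at `X w` as the integral of its
density, and exchange the integrals: the density at `x` gets weighted by the probability of `X < x`.
-/
theorem receiverLaw_prod_pi_no_outage (hN : 0 < N) (hM : 0 < M) (hPs : 0 < net.Ps)
    (hP : ∀ n, 0 < net.P n) (hPinj : Function.Injective net.P) (hσD : 0 < net.sigmaD)
    (hσE : ∀ m, 0 < net.sigmaE m) (hrate : 0 < net.rate) :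
    ((receiverLaw N).prod (Measure.pi fun _ : Fin M => receiverLaw N)).real
        {p | net.mu * ((⨆ m, net.sinr (net.sigmaE m) (p.2 m).1 (p.2 m).2) + 1) - 1
          ≤ net.sinr net.sigmaD p.1.1 p.1.2}
      = net.mu * Real.exp (net.xi * net.nu) * net.Y := by
  have hmu := one_pos.trans (net.one_lt_mu hrate)
  have hnu := net.nu_neg hrate
  set X : (Fin M → ℂ × (Fin N → ℂ)) → ℝ :=
    fun w => ⨆ m, net.sinr (net.sigmaE m) (w m).1 (w m).2 with hX
  have hXm : Measurable X := net.measurable_iSup_sinr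
  have hX0 : ∀ w, 0 ≤ X w := fun w => Real.iSup_nonneg fun m => net.sinr_nonneg hPs hP _ _ _
  have hYint := (net.hasIntegralIoi_integrandY hPs hP hσD hrate).1
  have hsplit : ∀ x, net.mu * Real.exp (net.xi * net.nu) * net.integrandY x = net.densityD x *
      ∏ i, (1 - net.Ps * Real.exp (-(net.sigmaE i ^ 2 * x / net.Ps)) *
          ∑ n, net.A n / (x + net.lam n)) := fun x => by
    rw [integrandY, densityD]
    ring
  have hnn : ∀ x ∈ Set.Ioi (0 : ℝ),
      0 ≤ net.mu * Real.exp (net.xi * net.nu) * net.integrandY x := fun x hx => by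
    rw [hsplit]
    exact mul_nonneg (net.densityD_nonneg hN hPs hP hPinj hrate hx) (Finset.prod_nonneg fun i _ =>
      (net.receiverLaw_sinr_lt hN hPs hP hPinj (hσE i) (le_of_lt hx)).1)
  have hYeq : net.mu * Real.exp (net.xi * net.nu) * net.Y
      = ∫ x in Set.Ioi (0 : ℝ), net.mu * Real.exp (net.xi * net.nu) * net.integrandY x := by
    rw [integral_const_mul, Y]
  rw [hYeq, measureReal_def, ← ENNReal.toReal_ofReal (setIntegral_nonneg measurableSet_Ioi hnn)]
  congr 1
  have hG : MeasurableSet {p : (ℂ × (Fin N → ℂ)) × (Fin M → ℂ × (Fin N → ℂ)) |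
      net.mu * (X p.2 + 1) - 1 ≤ net.sinr net.sigmaD p.1.1 p.1.2} :=
    measurableSet_le (by fun_prop) ((net.measurable_sinr net.sigmaD).comp measurable_fst)
  rw [ofReal_integral_eq_lintegral_ofReal (hYint.const_mul _)
      ((ae_restrict_iff' measurableSet_Ioi).2 (Filter.Eventually.of_forall hnn))]
  refine (Measure.prod_apply_symm hG).trans ?_
  have hin : ∀ w, receiverLaw N ((fun v => (v, w)) ⁻¹' {p : (ℂ × (Fin N → ℂ)) ×
        (Fin M → ℂ × (Fin N → ℂ)) | net.mu * (X p.2 + 1) - 1 ≤ net.sinr net.sigmaD p.1.1 p.1.2})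
      -- Since `X w ≥ 0`, integrating over `x > X w` is integrating an indicator over the fixed
      -- domain `x > 0`, as Tonelli needs.
      = ∫⁻ x in Set.Ioi (0 : ℝ), ENNReal.ofReal (net.densityD x) *
          Set.indicator {w | X w < x} (fun _ => 1) w := by
    intro w
    have h1 : net.mu * (X w + 1) - 1 = net.mu * (X w - net.nu) := by
      rw [nu_eq, mul_sub, mul_sub, mul_inv_cancel₀ hmu.ne']
      ring
    have h2 : 0 ≤ net.mu * (X w - net.nu) := mul_nonneg hmu.le (by linarith [hX0 w])
    simp only [Set.preimage_ofPred_eq, h1]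
    rw [net.receiverLaw_le_sinr hPs hP hσD h2]
    change ENNReal.ofReal (net.survivalD (X w)) = _
    rw [← net.lintegral_densityD hN hPs hP hPinj hσD hrate (hX0 w),
      ← lintegral_indicator measurableSet_Ioi, ← lintegral_indicator measurableSet_Ioi]
    refine lintegral_congr fun x => ?_
    by_cases hx : X w < x
    · rw [Set.indicator_of_mem (show x ∈ Set.Ioi (X w) from hx),
        Set.indicator_of_mem (show x ∈ Set.Ioi (0 : ℝ) from (hX0 w).trans_lt hx),
        Set.indicator_of_mem (show w ∈ {w | X w < x} from hx), mul_one]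
    · rw [Set.indicator_of_notMem (show x ∉ Set.Ioi (X w) from hx)]
      by_cases hx0 : x ∈ Set.Ioi (0 : ℝ)
      · rw [Set.indicator_of_mem hx0, Set.indicator_of_notMem (show w ∉ {w | X w < x} from hx),
          mul_zero]
      · rw [Set.indicator_of_notMem hx0]
  rw [lintegral_congr hin, lintegral_lintegral_swap]
  · refine setLIntegral_congr_fun measurableSet_Ioi fun x hx => ?_
    have hms : MeasurableSet {w | X w < x} := measurableSet_lt hXm measurable_const
    rw [lintegral_const_mul _ (measurable_const.indicator hms), lintegral_indicator hms,
      setLIntegral_const, one_mul, hsplit,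
      ENNReal.ofReal_mul (net.densityD_nonneg hN hPs hP hPinj hrate hx),
      net.pi_receiverLaw_iSup_sinr_lt hN hM hPs hP hPinj hσE (le_of_lt hx)]
  · refine Measurable.aemeasurable ?_
    refine Measurable.mul ((ENNReal.measurable_ofReal.comp
      net.measurable_densityD).comp measurable_snd) ?_
    exact (measurable_const (a := (1 : ENNReal))).indicator
      (measurableSet_lt (hXm.comp measurable_fst) measurable_snd)

end JammingNetwork

/-! ### From the fading model to the product law, and the outage event -/

/-- The channel coefficients grouped by receiver. -/
def groupByReceiver {N M : ℕ} (x : Option (Fin M) × Option (Fin N) → ℂ) :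
    (ℂ × (Fin N → ℂ)) × (Fin M → ℂ × (Fin N → ℂ)) :=
  ((x (none, none), fun n => x (none, some n)),
    fun m => (x (some m, none), fun n => x (some m, some n)))

theorem measurable_groupByReceiver {N M : ℕ} :
    Measurable (groupByReceiver : (Option (Fin M) × Option (Fin N) → ℂ) → _) := by
  unfold groupByReceiver
  fun_prop

/-- The inverse regrouping `ψ` pulls boxes back to boxes, so it carries the nested product measure
to the flat one. -/
theorem map_groupByReceiver {N M : ℕ} :
    (Measure.pi fun _ : Option (Fin M) × Option (Fin N) => stdComplexGaussian).map groupByReceiver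
      = (receiverLaw N).prod (Measure.pi fun _ : Fin M => receiverLaw N) := by
  set ψ : (ℂ × (Fin N → ℂ)) × (Fin M → ℂ × (Fin N → ℂ)) → Option (Fin M) × Option (Fin N) → ℂ :=
    fun v c => channelFamily (fun v : (ℂ × (Fin N → ℂ)) × (Fin M → ℂ × (Fin N → ℂ)) => v.1.1)
      (fun n v => v.1.2 n) (fun m v => (v.2 m).1) (fun m n v => (v.2 m).2 n) c v with hψ
  have hψm : Measurable ψ := by
    refine measurable_pi_iff.2 ?_
    rintro ⟨_ | m, _ | n⟩ <;> simp only [hψ, channelFamily] <;> fun_prop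
  have hpi : (Measure.pi fun _ : Option (Fin M) × Option (Fin N) => stdComplexGaussian)
      = ((receiverLaw N).prod (Measure.pi fun _ : Fin M => receiverLaw N)).map ψ := by
    refine Measure.pi_eq fun s hs => ?_
    rw [Measure.map_apply hψm (MeasurableSet.univ_pi hs)]
    have hset : ψ ⁻¹' Set.univ.pi s
        = (s (none, none) ×ˢ Set.univ.pi fun n => s (none, some n)) ×ˢ
          Set.univ.pi fun m => s (some m, none) ×ˢ Set.univ.pi fun n => s (some m, some n) := by
      ext v
      simp only [Set.mem_preimage, Set.mem_pi, Set.mem_univ, true_implies, Set.mem_prod]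
      constructor
      · intro h
        exact ⟨⟨h (none, none), fun n => h (none, some n)⟩,
          fun m => ⟨h (some m, none), fun n => h (some m, some n)⟩⟩
      · rintro ⟨⟨h1, h2⟩, h3⟩ ⟨_ | m, _ | n⟩
        · exact h1
        · exact h2 n
        · exact (h3 m).1
        · exact (h3 m).2 n
    rw [hset, Measure.prod_prod, Measure.pi_pi, Fintype.prod_prod_type, Fintype.prod_option]
    simp only [receiverLaw, Measure.prod_prod, Measure.pi_pi, Fintype.prod_option]
  rw [hpi, Measure.map_map measurable_groupByReceiver hψm]
  exact Measure.map_id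

theorem IsRayleighFading.hasLaw_groupByReceiver {N M : ℕ} {Ω : Type*} [MeasurableSpace Ω]
    {Pr : Measure Ω} [IsProbabilityMeasure Pr] {hD : Ω → ℂ} {gD : Fin N → Ω → ℂ}
    {hE : Fin M → Ω → ℂ} {gE : Fin M → Fin N → Ω → ℂ} (h : IsRayleighFading Pr hD gD hE gE) :
    HasLaw (fun ω => ((hD ω, fun n => gD n ω), fun m => (hE m ω, fun n => gE m n ω)))
      ((receiverLaw N).prod (Measure.pi fun _ : Fin M => receiverLaw N)) Pr := by
  have hm : ∀ c, AEMeasurable (channelFamily hD gD hE gE c) Pr := fun c => (h.hasLaw c).aemeasurable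
  have hmap := (iIndepFun_iff_map_fun_eq_pi_map hm).1 h.indep
  simp only [fun c => (h.hasLaw c).map_eq] at hmap
  have hU : AEMeasurable (fun ω c => channelFamily hD gD hE gE c ω) Pr := aemeasurable_pi_iff.2 hm
  refine ⟨measurable_groupByReceiver.comp_aemeasurable hU, ?_⟩
  rw [← map_groupByReceiver, ← hmap,
    AEMeasurable.map_map_of_aemeasurable measurable_groupByReceiver.aemeasurable hU]
  rfl

/-- With `A` the event of positive secrecy and `G ⊆ A` that of no outage, the two terms are the
probabilities of `A \ G` and `Aᶜ`. -/
theorem secrecyOutageProbability_eq {Ω : Type*} [MeasurableSpace Ω] (Pr : Measure Ω)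
    [IsProbabilityMeasure Pr] {γD γE : Ω → ℝ} (hD : AEMeasurable γD Pr) (hE : AEMeasurable γE Pr)
    (hD0 : ∀ ω, 0 ≤ γD ω) (hE0 : ∀ ω, 0 ≤ γE ω) {R : ℝ} (hR : 0 < R) :
    secrecyOutageProbability Pr γD γE R
      = 1 - Pr.real {ω | (2 : ℝ) ^ R * (γE ω + 1) - 1 ≤ γD ω} := by
  have hmu : 1 < (2 : ℝ) ^ R := Real.one_lt_rpow one_lt_two hR
  set A : Set Ω := {ω | γE ω < γD ω} with hA
  set B : Set Ω := {ω | Real.logb 2 ((γD ω + 1) / (γE ω + 1)) < R} with hB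
  set G : Set Ω := {ω | (2 : ℝ) ^ R * (γE ω + 1) - 1 ≤ γD ω} with hG
  have hAm : NullMeasurableSet A Pr := nullMeasurableSet_lt hE hD
  have hGm : NullMeasurableSet G Pr :=
    nullMeasurableSet_le (((hE.add_const 1).const_mul _).sub_const 1) hD
  have hBG : ∀ ω, ω ∈ B ↔ ω ∉ G := by
    intro ω
    have h1 : 0 < γE ω + 1 := by linarith [hE0 ω]
    have h2 : 0 < (γD ω + 1) / (γE ω + 1) := div_pos (by linarith [hD0 ω]) h1
    simp only [hB, hG, Set.mem_ofPred_eq]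
    rw [Real.logb_lt_iff_lt_rpow one_lt_two h2, div_lt_iff₀ h1, not_le]
    constructor <;> intro h <;> linarith
  have hGA : G ⊆ A := by
    intro ω hω
    have h1 : 0 < γE ω + 1 := by linarith [hE0 ω]
    simp only [hG, hA, Set.mem_ofPred_eq] at hω ⊢
    nlinarith
  have hcond : (ProbabilityTheory.cond Pr A).real B * Pr.real A = Pr.real (B ∩ A) := by
    rw [ProbabilityTheory.cond, measureReal_def, Measure.smul_apply,
      Measure.restrict_apply₀' hAm, smul_eq_mul, measureReal_def, measureReal_def,
      ← ENNReal.toReal_mul]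
    congr 1
    -- If the conditioning event is null, both sides vanish, whatever the conditional measure is.
    by_cases h0 : Pr A = 0
    · rw [h0, mul_zero, measure_mono_null Set.inter_subset_right h0]
    · rw [mul_comm, ← mul_assoc, ENNReal.mul_inv_cancel h0 (measure_ne_top _ _), one_mul]
  have hcompl : {ω | γD ω ≤ γE ω} = Aᶜ := by
    ext ω
    simp [hA]
  have hBA : B ∩ A = A \ G := by
    ext ω
    rw [Set.mem_inter_iff, hBG, Set.mem_sdiff, and_comm]
  rw [secrecyOutageProbability, hcond, hcompl, hBA, measureReal_compl₀ hAm,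
    probReal_univ]
  have hadd := measureReal_inter_add_sdiff₀ (μ := Pr) (s := A) hGm
  rw [Set.inter_eq_right.2 hGA] at hadd
  linarith

namespace JammingNetwork

theorem secrecyOutageProbability_eq_one_sub {N M : ℕ} (hN : 0 < N) (hM : 0 < M)
    (net : JammingNetwork N M)
    (hPs : 0 < net.Ps) (hP : ∀ n, 0 < net.P n) (hPinj : Function.Injective net.P)
    (hσD : 0 < net.sigmaD) (hσE : ∀ m, 0 < net.sigmaE m) (hrate : 0 < net.rate)
    {Ω : Type*} [MeasurableSpace Ω] (Pr : Measure Ω) [IsProbabilityMeasure Pr]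
    (hD : Ω → ℂ) (gD : Fin N → Ω → ℂ) (hE : Fin M → Ω → ℂ) (gE : Fin M → Fin N → Ω → ℂ)
    (hfading : IsRayleighFading Pr hD gD hE gE) :
    secrecyOutageProbability Pr (net.gammaD hD gD) (net.gammaEmax hE gE) net.rate
      = 1 - net.mu * Real.exp (net.xi * net.nu) * net.Y := by
  have hlaw := hfading.hasLaw_groupByReceiver
  have hDm : Measurable fun p : (ℂ × (Fin N → ℂ)) × (Fin M → ℂ × (Fin N → ℂ)) =>
    net.sinr net.sigmaD p.1.1 p.1.2 := (net.measurable_sinr net.sigmaD).comp measurable_fst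
  have hEm : Measurable fun p : (ℂ × (Fin N → ℂ)) × (Fin M → ℂ × (Fin N → ℂ)) =>
    ⨆ m, net.sinr (net.sigmaE m) (p.2 m).1 (p.2 m).2 :=
    net.measurable_iSup_sinr.comp measurable_snd
  have hT := hlaw.aemeasurable
  have hγD : AEMeasurable (net.gammaD hD gD) Pr := by
    unfold gammaD
    have h := hDm.comp_aemeasurable hT
    simp only [Function.comp_def] at h
    exact h
  have hγE : AEMeasurable (net.gammaEmax hE gE) Pr := by
    unfold gammaEmax
    have h := hEm.comp_aemeasurable hT
    simp only [Function.comp_def] at h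
    exact h
  rw [secrecyOutageProbability_eq Pr hγD hγE (fun ω => net.sinr_nonneg hPs hP _ _ _)
    (fun ω => Real.iSup_nonneg fun m => net.sinr_nonneg hPs hP _ _ _) hrate,
    ← net.receiverLaw_prod_pi_no_outage hN hM hPs hP hPinj hσD hσE hrate]
  have hG : MeasurableSet {p : (ℂ × (Fin N → ℂ)) × (Fin M → ℂ × (Fin N → ℂ)) |
      net.mu * ((⨆ m, net.sinr (net.sigmaE m) (p.2 m).1 (p.2 m).2) + 1) - 1
        ≤ net.sinr net.sigmaD p.1.1 p.1.2} :=
    measurableSet_le ((hEm.add_const 1).const_mul net.mu |>.sub_const 1) hDm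
  have hlawG := hlaw.measureReal_eq hG
  have hmu : (2 : ℝ) ^ net.rate = net.mu := rfl
  rw [← hlawG, hmu]
  simp only [gammaD, gammaEmax]

end JammingNetwork

end

theorem mainTheorem1 {N M : ℕ} (hN : 0 < N) (hM : 0 < M) (net : JammingNetwork N M)
    (hPs : 0 < net.Ps) (hP : ∀ n, 0 < net.P n) (hPinj : Function.Injective net.P)
    (hσD : 0 < net.sigmaD) (hσE : ∀ m, 0 < net.sigmaE m) (hrate : 0 < net.rate)
    {Ω : Type*} [MeasurableSpace Ω] (Pr : Measure Ω) [IsProbabilityMeasure Pr]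
    (hD : Ω → ℂ) (gD : Fin N → Ω → ℂ) (hE : Fin M → Ω → ℂ) (gE : Fin M → Fin N → Ω → ℂ)
    (hfading : IsRayleighFading Pr hD gD hE gE)
    (Pout : ℝ)
    (hPout : Pout = secrecyOutageProbability Pr (net.gammaD hD gD) (net.gammaEmax hE gE)
      net.rate) :
    -- single-integral form
    (IntegrableOn net.integrandY (Set.Ioi 0) ∧
      Pout = 1 - net.mu * Real.exp (net.xi * net.nu) * net.Y) ∧
    -- finite expansion in terms of the integrals `I_{ℓ,k}`
    (net.Y = net.expansionY basicIntegral ∧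
      Pout = 1 - net.mu * Real.exp (net.xi * net.nu) * net.expansionY basicIntegral) ∧
    -- closed-form evaluation of the integrals `I_{ℓ,k}`
    (∀ (l : ℕ) (k : Fin N → ℕ) (a₁ a₂ : ℝ) (a₃ : Fin N → ℝ), (l = 1 ∨ l = 2) →
      0 < a₁ → 0 < a₂ → (∀ n, 0 < k n → 0 < a₃ n) →
      (∀ n m, n ≠ m → 0 < k n → 0 < k m → a₃ n ≠ a₃ m) →
      IntegrableOn (basicIntegrand l k a₁ a₂ a₃) (Set.Ioi 0) ∧
      ((∀ n, 0 < k n → a₂ ≠ a₃ n) →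
        basicIntegral l k a₁ a₂ a₃ = closedFormDistinct l k a₁ a₂ a₃) ∧
      basicIntegral l k a₁ a₂ a₃ = closedForm l k a₁ a₂ a₃) ∧
    -- closed form of the secrecy outage probability
    ((∀ n m, net.kappa n ≠ net.lam m) →
      Pout = 1 - net.mu * Real.exp (net.xi * net.nu) * net.expansionY closedFormDistinct) ∧
    Pout = 1 - net.mu * Real.exp (net.xi * net.nu) * net.expansionY closedForm := by

  have hY := net.hasIntegralIoi_integrandY hPs hP hσD hrate
  have hYeq : net.Y = net.expansionY basicIntegral := hY.2
  have hout : Pout = 1 - net.mu * Real.exp (net.xi * net.nu) * net.Y :=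
    hPout.trans (net.secrecyOutageProbability_eq_one_sub hN hM hPs hP hPinj hσD hσE hrate Pr
      hD gD hE gE hfading)
  have hclosed := net.expansionY_basicIntegral_eq_closedForm hPs hP hPinj hσD hrate
  refine ⟨⟨hY.1, hout⟩, ⟨hYeq, hYeq ▸ hout⟩, ?_, fun h => ?_, ?_⟩
  · intro l k a₁ a₂ a₃ hl h₁ h₂ h₃ h₃₃
    have hl0 : 0 < l := by omega
    exact ⟨integrableOn_basicIntegrand l k h₁ (fun _ => h₂) h₃,
      fun h₂₃ => basicIntegral_eq_closedFormDistinct l k h₁ (fun _ => h₂) h₃ h₃₃ (fun _ => h₂₃)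
        (Or.inl hl0),
      basicIntegral_eq_closedForm hl0 k h₁ h₂ h₃ h₃₃⟩
  · rw [← net.expansionY_closedForm_eq_closedFormDistinct h, ← hclosed, ← hYeq]
    exact hout
  · rw [← hclosed, ← hYeq]
    exact hout
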